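/- Let $s,m,n_1,\dots,n_s\in\mathbb N$, $n=n_1+\dots+n_s\ge 1$, and let $E=\mathrm{diag}(E_1,\dots,E_s)$, $R=\mathrm{diag}(R_1,\dots,R_s)$, $Q=\mathrm{diag}(Q_1,\dots,Q_s)$ and $J_d=\mathrm{diag}(J_1,\dots,J_s)$ be block diagonal with $E_i,R_i,Q_i,J_i\in\mathbb R^{n_i\times n_i}$, $R_i=R_i^\top\ge0$, $J_i^\top=-J_i$, $E_i^\top Q_i=Q_i^\top E_i\ge 0$ and $Q_i$ invertible. Let $J_o\in\mathbb R^{n\times n}$ have zero diagonal blocks, arbitrary blocks $J_{ij}\in\mathbb R^{n_i\times n_j}$ for $i<j$, and blocks $-J_{ji}^\top$ for $i>j$. Put $J=J_d+J_o$, let $B\in\mathbb R^{n\times m}$, and assume $\mathrm{rk}[E\ R\ J]=n$. Let $T>0$, $x_0\in\mathbb R^n$, $u\in L^2([0,T];\mathbb R^m)$, and assume the following consistency condition: for matrices $Z\in\mathbb R^{n\times r}$, $Z_1\in\mathbb R^{r\times r_1}$ of full column rank with $\mathrm{im}\,Z=\ker E$ and $\mathrm{im}\,Z_1=\ker RQZ\cap\ker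 Z^\top Q^\top JQZ$, one has $Z_1^\top Z^\top Q^\top Bu\in H^1([0,T];\mathbb R^{r_1})$ and $Z_1^\top Z^\top Q^\top(JQx_0+Bu(0))=0$. Let $x\in L^2([0,T];\mathbb R^n)$ be the (unique) weak solution of $$\tfrac{d}{dt}Ex=(J-R)Qx+Bu,\qquad Ex(0)=Ex_0,$$ that is, $Ex\in H^1$, $Ex(0)=Ex_0$, and the equation holds almost everywhere on $[0,T]$. Let $\lambda>0$, $\mu\ge0$, $\alpha\in[0,1]$. On $D(M)=\{x\in L^2([0,T];\mathbb R^n)\mid Ex\in H^1,\ Ex(0)=Ex_0\}$ define $Mx=\tfrac{d}{dt}(Ex)-(J_d-\alpha R+\mu EQ^{-1})Qx-Bu$, and on $L^2([0,T];\mathbb R^n)$ define $Nx=KQx$ with $K=(1-\alpha)R+\mu EQ^{-1}-J_o$. Let $x^0\in D(M)$ and, for $k\ge 0$, $$x^{k+1}=Q^{-1}(I+\lambda MQ^{-1})^{-1}(I-\lambda NQ^{-1})(I+\lambda NQ^{-1})^{-1}(I-\lambda MQ^{-1})Qx^k.$$ Put $z^k=(I+\lambda MQ^{-1})Qx^k$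 and $z=(I+\lambda MQ^{-1})Qx$, and let $\|f\|_{2,\omega}^2=\int_0^Te^{-2t\omega}\|f(t)\|^2\,dt$. Then the following hold. (a) If $\mathrm{rk}[\mu E\ \ (1-\alpha)R]=n$, then the number $q\ge 0$ with $$q^2=1-\frac{4\lambda}{(1+\lambda\|K\|)^2\,\|(K+J_o)^{-1}\|}$$ (spectral norms) exists and satisfies $q<1$; for all $\omega\ge\mu$ and all $k$, $\|z^{k+1}-z\|_{2,\omega}\le q\,\|z^k-z\|_{2,\omega}$; and for all $k$, $\|z^k-z\|_{L^2}\le e^{\mu T}q^k\|z^0-z\|_{L^2}$. In particular $z^k\to z$ in $L^2([0,T];\mathbb R^n)$. Moreover $Ex^k\to Ex$ in $H^1([0,T];\mathbb R^n)$. (b) If $\mathrm{rk}[\mu E\ \ (1-\alpha)R]=n$ or $\mathrm{rk}[E\ \ \alpha R]=n$, then $x^k\to x$ in $L^2([0,T];\mathbb R^n)$. -/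

import Mathlib

open MeasureTheory Filter Topology
open scoped ContDiff Matrix

noncomputable section

/-! ## The spaces `L²([0,T], ℝ^ι)` and `H¹([0,T], ℝ^ι)` -/

/-- `L²([0,T], ℝ^ι)`, where `ℝ^ι` carries the Euclidean norm. -/
abbrev L2 (T : ℝ) (ι : Type) [Fintype ι] : Type :=
  Lp (EuclideanSpace ℝ ι) 2 (volume.restrict (Set.Icc (0 : ℝ) T))

/-- A real matrix acting on Euclidean vectors. -/
def matVec {ι κ : Type} [Fintype ι] [Fintype κ] [DecidableEq κ]
    (A : Matrix ι κ ℝ) : EuclideanSpace ℝ κ →L[ℝ] EuclideanSpace ℝ ι :=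
  LinearMap.toContinuousLinearMap (Matrix.toEuclideanLin A)

/-- The spectral norm of a matrix. -/
def specNorm {ι κ : Type} [Fintype ι] [Fintype κ] [DecidableEq κ] (A : Matrix ι κ ℝ) : ℝ :=
  ‖matVec A‖

/-- The multiplication operator `x ↦ (t ↦ A x(t))` between `L²` spaces. -/
def mulOp (T : ℝ) {ι κ : Type} [Fintype ι] [Fintype κ] [DecidableEq κ]
    (A : Matrix ι κ ℝ) : L2 T κ →L[ℝ] L2 T ι :=
  (matVec A).compLpL 2 (volume.restrict (Set.Icc (0 : ℝ) T))

/-- `g` is the weak derivative of `f` on `(0,T)`, tested against smooth functions with compact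
support in `(0,T)`. -/
def IsWeakDeriv {T : ℝ} {ι : Type} [Fintype ι] (f g : L2 T ι) : Prop :=
  ∀ φ : ℝ → ℝ, ContDiff ℝ ∞ φ → HasCompactSupport φ → tsupport φ ⊆ Set.Ioo 0 T →
    ∫ t in Set.Icc 0 T, deriv φ t • f t = - ∫ t in Set.Icc 0 T, φ t • g t

/-- `H¹([0,T], ℝ^ι)`. -/
def H1 (T : ℝ) (ι : Type) [Fintype ι] : Set (L2 T ι) := {f | ∃ g, IsWeakDeriv f g}

open Classical in
/-- The weak derivative of `f` (zero if `f` is not in `H¹`). -/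
def weakDeriv {T : ℝ} {ι : Type} [Fintype ι] (f : L2 T ι) : L2 T ι :=
  if h : ∃ g, IsWeakDeriv f g then h.choose else 0

/-- The norm of `H¹([0,T], ℝ^ι)` (meaningful for elements of `H1 T ι`). -/
def h1Norm {T : ℝ} {ι : Type} [Fintype ι] (f : L2 T ι) : ℝ :=
  Real.sqrt (‖f‖ ^ 2 + ‖weakDeriv f‖ ^ 2)

/-- The continuous representative of `f` takes the value `c` at `0`. -/
def HasInitialValue {T : ℝ} {ι : Type} [Fintype ι] (f : L2 T ι) (c : EuclideanSpace ℝ ι) : Prop :=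
  ∃ F : ℝ → EuclideanSpace ℝ ι, ContinuousOn F (Set.Icc 0 T) ∧
    (∀ᵐ t ∂(volume.restrict (Set.Icc (0 : ℝ) T)), f t = F t) ∧ F 0 = c

/-- The weighted norm `‖f‖_{2,w}`, with `‖f‖_{2,w}² = ∫₀ᵀ e^{-2tw} ‖f(t)‖² dt`. -/
def wNorm {T : ℝ} {ι : Type} [Fintype ι] (w : ℝ) (f : L2 T ι) : ℝ :=
  Real.sqrt (∫ t in Set.Icc 0 T, Real.exp (-2 * t * w) * ‖f t‖ ^ 2)

/-! ## Coupled port-Hamiltonian initial value problems -/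

/-- The data of an initial value problem
`d/dt E x = (J - R) Q x + B u`, `E x(0) = E x₀` on `[0,T]` made of `s` coupled subsystems of
sizes `n 0, …, n (s-1)`. Of the coupling blocks `Jc i j` only those with `i < j` are used. -/
structure CoupledDAE (s m : ℕ) (n : Fin s → ℕ) where
  Eb : ∀ i, Matrix (Fin (n i)) (Fin (n i)) ℝ
  Rb : ∀ i, Matrix (Fin (n i)) (Fin (n i)) ℝ
  Qb : ∀ i, Matrix (Fin (n i)) (Fin (n i)) ℝ
  Jb : ∀ i, Matrix (Fin (n i)) (Fin (n i)) ℝ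
  Jc : ∀ i j, Matrix (Fin (n i)) (Fin (n j)) ℝ
  Bb : ∀ i, Matrix (Fin (n i)) (Fin m) ℝ
  T : ℝ
  x₀ : EuclideanSpace ℝ ((i : Fin s) × Fin (n i))
  u : L2 T (Fin m)

namespace CoupledDAE

variable {s m : ℕ} {n : Fin s → ℕ} (S : CoupledDAE s m n)

/-- The index set of the overall state, of cardinality `n 0 + ⋯ + n (s-1)`. -/
abbrev Idx (n : Fin s → ℕ) : Type := (i : Fin s) × Fin (n i)

def E : Matrix (Idx n) (Idx n) ℝ := Matrix.blockDiagonal' S.Eb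
def R : Matrix (Idx n) (Idx n) ℝ := Matrix.blockDiagonal' S.Rb
def Q : Matrix (Idx n) (Idx n) ℝ := Matrix.blockDiagonal' S.Qb

/-- The block diagonal part of `J`. -/
def Jd : Matrix (Idx n) (Idx n) ℝ := Matrix.blockDiagonal' S.Jb

/-- The off-diagonal part of `J`: `J_ij` above the diagonal and `-J_jiᵀ` below it. -/
def Jo : Matrix (Idx n) (Idx n) ℝ := Matrix.of fun p q =>
  if p.1 < q.1 then S.Jc p.1 q.1 p.2 q.2
  else if q.1 < p.1 then - S.Jc q.1 p.1 q.2 p.2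
  else 0

def J : Matrix (Idx n) (Idx n) ℝ := S.Jd + S.Jo

def B : Matrix (Idx n) (Fin m) ℝ := Matrix.of fun p => S.Bb p.1 p.2

/-- The standing assumptions on an overall coupled port-Hamiltonian DAE. -/
structure Admissible : Prop where
  R_psd : ∀ i, (S.Rb i).PosSemidef
  J_skew : ∀ i, (S.Jb i)ᵀ = - S.Jb i
  EQ_symm : ∀ i, (S.Eb i)ᵀ * S.Qb i = (S.Qb i)ᵀ * S.Eb i
  EQ_psd : ∀ i, ((S.Eb i)ᵀ * S.Qb i).PosSemidef
  Q_unit : ∀ i, IsUnit (S.Qb i)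
  rank_ERJ : (Matrix.fromCols S.E (Matrix.fromCols S.R S.J)).rank = ∑ i, n i
  T_pos : 0 < S.T
  /-- Smoothness of the input and consistency of the initial value. -/
  consistent : ∃ (r r₁ : ℕ) (Z : Matrix (Idx n) (Fin r) ℝ) (Z₁ : Matrix (Fin r) (Fin r₁) ℝ),
    Z.rank = r ∧ Z₁.rank = r₁ ∧
    LinearMap.range Z.mulVecLin = LinearMap.ker S.E.mulVecLin ∧
    LinearMap.range Z₁.mulVecLin =
      LinearMap.ker (S.R * S.Q * Z).mulVecLin ⊓
        LinearMap.ker (Zᵀ * S.Qᵀ * S.J * S.Q * Z).mulVecLin ∧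
    mulOp S.T (Z₁ᵀ * Zᵀ * S.Qᵀ * S.B) S.u ∈ H1 S.T (Fin r₁) ∧
    ∃ b₀ : EuclideanSpace ℝ (Fin r₁),
      HasInitialValue (mulOp S.T (Z₁ᵀ * Zᵀ * S.Qᵀ * S.B) S.u) b₀ ∧
      matVec (Z₁ᵀ * Zᵀ * S.Qᵀ * S.J * S.Q) S.x₀ + b₀ = 0

/-- The common domain `{x ∈ L² | E x ∈ H¹, E x(0) = E x₀}` of the solutions and of `M`. -/
def dom : Set (L2 S.T (Idx n)) :=
  {x | mulOp S.T S.E x ∈ H1 S.T (Idx n) ∧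
    HasInitialValue (mulOp S.T S.E x) (matVec S.E S.x₀)}

/-- Weak solutions of `d/dt E x = (J - R) Q x + B u`, `E x(0) = E x₀`. -/
def IsSolution (x : L2 S.T (Idx n)) : Prop :=
  x ∈ S.dom ∧
    weakDeriv (mulOp S.T S.E x) = mulOp S.T ((S.J - S.R) * S.Q) x + mulOp S.T S.B S.u

/-- The affine operator `M`, to be used on its domain `S.dom` only. -/
def M (α μ : ℝ) (x : L2 S.T (Idx n)) : L2 S.T (Idx n) :=
  weakDeriv (mulOp S.T S.E x)
    - mulOp S.T ((S.Jd - α • S.R + μ • (S.E * S.Q⁻¹)) * S.Q) x - mulOp S.T S.B S.u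

/-- The bounded multiplication operator `N`. -/
def N (α μ : ℝ) : L2 S.T (Idx n) →L[ℝ] L2 S.T (Idx n) :=
  mulOp S.T (((1 - α) • S.R + μ • (S.E * S.Q⁻¹) - S.Jo) * S.Q)

/-- The operator `M Q⁻¹`, with domain `Q S.dom`. -/
def MQ (α μ : ℝ) (v : L2 S.T (Idx n)) : L2 S.T (Idx n) := S.M α μ (mulOp S.T (S.Q⁻¹) v)

/-- The operator `N Q⁻¹`. -/
def NQ (α μ : ℝ) : L2 S.T (Idx n) →L[ℝ] L2 S.T (Idx n) := S.N α μ ∘L mulOp S.T (S.Q⁻¹)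

/-- The resolvent `(I + l M Q⁻¹)⁻¹`, the inverse of `I + l M Q⁻¹` on the domain `Q S.dom`. -/
def resolventMQ (α μ l : ℝ) : L2 S.T (Idx n) → L2 S.T (Idx n) :=
  Function.invFunOn (fun v => v + l • S.MQ α μ v) (mulOp S.T S.Q '' S.dom)

/-- One step `Q⁻¹ (I + l M Q⁻¹)⁻¹ (I - l N Q⁻¹) (I + l N Q⁻¹)⁻¹ (I - l M Q⁻¹) Q x` of the
iteration. -/
def step (α μ l : ℝ) (x : L2 S.T (Idx n)) : L2 S.T (Idx n) :=
  mulOp S.T (S.Q⁻¹) (S.resolventMQ α μ l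
    ((1 - l • S.NQ α μ) (Ring.inverse (1 + l • S.NQ α μ)
      (mulOp S.T S.Q x - l • S.MQ α μ (mulOp S.T S.Q x)))))

/-- `(I + l M Q⁻¹) Q x`. -/
def zOf (α μ l : ℝ) (x : L2 S.T (Idx n)) : L2 S.T (Idx n) :=
  mulOp S.T S.Q x + l • S.MQ α μ (mulOp S.T S.Q x)

/-- The matrix `K = (1 - α) R + μ E Q⁻¹ - J_o`. -/
def K (α μ : ℝ) : Matrix (Idx n) (Idx n) ℝ :=
  (1 - α) • S.R + μ • (S.E * S.Q⁻¹) - S.Jo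

/-- The condition `rk [μ E, (1 - α) R] = n`. -/
def RankCond (α μ : ℝ) : Prop :=
  (Matrix.fromCols (μ • S.E) ((1 - α) • S.R)).rank = ∑ i, n i

/-- The condition `rk [E, α R] = n`. -/
def RankCond' (α : ℝ) : Prop :=
  (Matrix.fromCols S.E (α • S.R)).rank = ∑ i, n i

end CoupledDAE

end

noncomputable section

open scoped InnerProductSpace BoundedContinuousFunction

/-! ### Matrix multiplication operators on `L²`. -/

section MulOp

variable {T : ℝ} {ι κ τ : Type} [Fintype ι] [Fintype κ] [Fintype τ] [DecidableEq κ]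
  [DecidableEq τ]

/-! Write `v = Qx` and `P = E Q⁻¹`. The structural assumptions make `P` positive semidefinite, and
the equation becomes `0 = M Q⁻¹ v + K v`, with `M Q⁻¹ v = (Pv)' - A v - Bu` and `A = J_d - αR + μP`.
The skew parts drop out of quadratic forms, so `K` has symmetric part `(1-α)R + μP`. Differences in
the domain of `M` satisfy `Pd(0) = 0`; integrating by parts against `e^{-2tw}` gives `⟨(Pd)', d⟩ ≥
w⟨Pd, d⟩`. Hence `M Q⁻¹` is monotone in the weighted space, with defect at least `⟨d, (αR + (w-μ)P)
d⟩` (`inner_MQ_ge`); this is why `w ≥ μ` is needed.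

The iteration is a Peaceman–Rachford scheme. With `d = Q(x^k - x)` and `g` the difference of the
values of `M Q⁻¹`, one has `z^k - z = d + λg`, while for a suitable `y`, `d - λg = (I + λK)y` and
`z^{k+1} - z = (I - λK)y` (`exists_error_step`). The identity `‖a + λb‖² = ‖a - λb‖² + 4λ⟨a, b⟩`
turns monotonicity into decay, once for `M` and once for `K`.

Under the first rank condition the symmetric part of `K` is positive definite and the step for `K`
contracts with factor `q` (`cayley_contraction`). Convergence of `z^k` passes to `x^k` because the
resolvent is nonexpansive, and to `(Ex^k)'` because this derivative is a continuous function of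
`z^k` and `x^k`. Under the second rank condition the weight `w = μ + 1` makes `αR + (w-μ)P` positive
definite. The defect of `M` is then bounded by the decrements of `‖z^k - z‖²`, which tend to zero.

The iteration is well defined because `I + λM Q⁻¹` is onto, which amounts to solving an index-one
differential-algebraic equation (`exists_dae_solution`). -/

lemma matVec_mul (A : Matrix ι κ ℝ) (B : Matrix κ τ ℝ) :
    matVec (A * B) = (matVec A).comp (matVec B) := by
  ext1 v
  simp [matVec, Matrix.toLpLin_apply, Matrix.mulVec_mulVec]

lemma matVec_one [DecidableEq ι] : matVec (1 : Matrix ι ι ℝ) = ContinuousLinearMap.id ℝ _ := by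
  ext1 v
  simp [matVec]

lemma inner_matVec [DecidableEq ι] (A : Matrix ι κ ℝ) (v : EuclideanSpace ℝ κ) (w : EuclideanSpace ℝ ι) :
    ⟪matVec A v, w⟫_ℝ = ⟪v, matVec Aᵀ w⟫_ℝ := by
  simp only [matVec, LinearMap.coe_toContinuousLinearMap', Matrix.toLpLin_apply,
    EuclideanSpace.inner_eq_star_dotProduct, star_trivial]
  rw [Matrix.mulVec_transpose, dotProduct_comm, ← Matrix.dotProduct_mulVec, dotProduct_comm,
    dotProduct_comm]

lemma mulOp_ae (A : Matrix ι κ ℝ) (f : L2 T κ) :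
    ∀ᵐ t ∂(volume.restrict (Set.Icc (0 : ℝ) T)), mulOp T A f t = matVec A (f t) :=
  (matVec A).coeFn_compLpL f

lemma mulOp_add (A B : Matrix ι κ ℝ) : mulOp T (A + B) = mulOp T A + mulOp T B := by
  unfold mulOp
  rw [← ContinuousLinearMap.add_compLpL]
  congr 1
  simp [matVec]

lemma mulOp_smul (c : ℝ) (A : Matrix ι κ ℝ) : mulOp T (c • A) = c • mulOp T A := by
  unfold mulOp
  rw [← ContinuousLinearMap.smul_compLpL]
  congr 1
  simp [matVec]

lemma mulOp_neg (A : Matrix ι κ ℝ) : mulOp T (-A) = -mulOp T A := by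
  simpa using mulOp_smul (T := T) (-1) A

lemma mulOp_sub (A B : Matrix ι κ ℝ) : mulOp T (A - B) = mulOp T A - mulOp T B := by
  rw [sub_eq_add_neg, mulOp_add, mulOp_neg, sub_eq_add_neg]

lemma mulOp_zero : mulOp T (0 : Matrix ι κ ℝ) = 0 := by
  simpa using mulOp_smul (T := T) 0 (0 : Matrix ι κ ℝ)

lemma mulOp_mul_apply (A : Matrix ι κ ℝ) (B : Matrix κ τ ℝ) (f : L2 T τ) :
    mulOp T (A * B) f = mulOp T A (mulOp T B f) := by
  apply Lp.ext
  filter_upwards [mulOp_ae (A * B) f, mulOp_ae A (mulOp T B f), mulOp_ae B f] with t h1 h2 h3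
  rw [h1, h2, h3, matVec_mul]
  rfl

lemma mulOp_one [DecidableEq ι] : mulOp T (1 : Matrix ι ι ℝ) = 1 := by
  ext1 f
  apply Lp.ext
  filter_upwards [mulOp_ae (1 : Matrix ι ι ℝ) f] with t h1
  rw [h1, matVec_one]
  rfl

lemma mulOp_one_apply [DecidableEq ι] (f : L2 T ι) : mulOp T (1 : Matrix ι ι ℝ) f = f := by
  rw [mulOp_one]; rfl

lemma inner_mulOp [DecidableEq ι] (A : Matrix ι κ ℝ) (f : L2 T κ) (g : L2 T ι) :
    ⟪mulOp T A f, g⟫_ℝ = ⟪f, mulOp T Aᵀ g⟫_ℝ := by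
  rw [L2.inner_def, L2.inner_def]
  apply integral_congr_ae
  filter_upwards [mulOp_ae A f, mulOp_ae Aᵀ g] with t h1 h2
  rw [h1, h2, inner_matVec]

lemma norm_mulOp_le (A : Matrix ι κ ℝ) (f : L2 T κ) : ‖mulOp T A f‖ ≤ specNorm A * ‖f‖ :=
  (ContinuousLinearMap.le_opNorm _ f).trans
    (mul_le_mul_of_nonneg_right (ContinuousLinearMap.norm_compLpL_le _) (norm_nonneg f))

/-- Constant functions. -/
def constOp (T : ℝ) (ι : Type) [Fintype ι] : EuclideanSpace ℝ ι →L[ℝ] L2 T ι :=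
  Lp.constL 2 (volume.restrict (Set.Icc (0 : ℝ) T)) ℝ

lemma constOp_ae (c : EuclideanSpace ℝ ι) :
    ∀ᵐ t ∂(volume.restrict (Set.Icc (0 : ℝ) T)), constOp T ι c t = c :=
  Lp.coeFn_const _ _ c

lemma mulOp_constOp (A : Matrix ι κ ℝ) (c : EuclideanSpace ℝ κ) :
    mulOp T A (constOp T κ c) = constOp T ι (matVec A c) := by
  apply Lp.ext
  filter_upwards [mulOp_ae A (constOp T κ c), constOp_ae c, constOp_ae (matVec A c)] with t h1 h2 h3
  rw [h1, h2, h3]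

end MulOp

/-! ### Exponential weights, realised as multiplication operators. -/

section Weight

variable {T : ℝ} {ι κ : Type} [Fintype ι] [Fintype κ] [DecidableEq κ]

lemma memLp_exp_smul (w : ℝ) (f : L2 T ι) :
    MemLp (fun t => Real.exp (-(t * w)) • f t) 2 (volume.restrict (Set.Icc (0 : ℝ) T)) := by
  refine MemLp.of_le_mul (c := Real.exp (|T| * |w|)) (Lp.memLp f) ?_ ?_
  · have hc : Continuous fun t : ℝ => Real.exp (-(t * w)) := by fun_prop
    exact hc.aestronglyMeasurable.smul (Lp.aestronglyMeasurable f)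
  · filter_upwards [ae_restrict_mem measurableSet_Icc] with t ht
    rw [norm_smul, Real.norm_of_nonneg (Real.exp_pos _).le]
    refine mul_le_mul_of_nonneg_right (Real.exp_le_exp.2 ?_) (norm_nonneg _)
    calc -(t * w) ≤ |t * w| := neg_le_abs _
      _ = |t| * |w| := abs_mul _ _
      _ ≤ |T| * |w| := by
        refine mul_le_mul_of_nonneg_right ?_ (abs_nonneg _)
        rw [abs_of_nonneg ht.1]
        exact ht.2.trans (le_abs_self T)

/-- Multiplication by `exp (-t w)`. -/
def expOp (T : ℝ) (ι : Type) [Fintype ι] (w : ℝ) : L2 T ι →L[ℝ] L2 T ι :=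
  LinearMap.mkContinuous
    { toFun := fun f => (memLp_exp_smul w f).toLp _
      map_add' := fun f g => by
        apply Lp.ext
        filter_upwards [(memLp_exp_smul w (f + g)).coeFn_toLp, (memLp_exp_smul w f).coeFn_toLp,
          (memLp_exp_smul w g).coeFn_toLp, Lp.coeFn_add f g,
          Lp.coeFn_add ((memLp_exp_smul w f).toLp _) ((memLp_exp_smul w g).toLp _)]
          with t h1 h2 h3 h4 h5
        rw [h1, h5, Pi.add_apply, h2, h3, h4, Pi.add_apply, smul_add]
      map_smul' := fun c f => by
        apply Lp.ext
        filter_upwards [(memLp_exp_smul w (c • f)).coeFn_toLp, (memLp_exp_smul w f).coeFn_toLp,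
          Lp.coeFn_smul c f, Lp.coeFn_smul c ((memLp_exp_smul w f).toLp _)]
          with t h1 h2 h4 h5
        rw [h1, RingHom.id_apply, h5, Pi.smul_apply, h2, h4, Pi.smul_apply, smul_comm] }
    (Real.exp (|T| * |w|)) (fun f => by
      refine Lp.norm_le_mul_norm_of_ae_le_mul ?_
      filter_upwards [(memLp_exp_smul w f).coeFn_toLp, ae_restrict_mem measurableSet_Icc]
        with t h1 ht
      change ‖(memLp_exp_smul w f).toLp _ t‖ ≤ _
      rw [h1, norm_smul, Real.norm_of_nonneg (Real.exp_pos _).le]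
      refine mul_le_mul_of_nonneg_right (Real.exp_le_exp.2 ?_) (norm_nonneg _)
      calc -(t * w) ≤ |t * w| := neg_le_abs _
        _ = |t| * |w| := abs_mul _ _
        _ ≤ |T| * |w| := by
          refine mul_le_mul_of_nonneg_right ?_ (abs_nonneg _)
          rw [abs_of_nonneg ht.1]
          exact ht.2.trans (le_abs_self T))

lemma expOp_ae (w : ℝ) (f : L2 T ι) : ∀ᵐ t ∂(volume.restrict (Set.Icc (0 : ℝ) T)),
    expOp T ι w f t = Real.exp (-(t * w)) • f t :=
  (memLp_exp_smul w f).coeFn_toLp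

lemma expOp_mulOp (w : ℝ) (A : Matrix ι κ ℝ) (f : L2 T κ) :
    expOp T ι w (mulOp T A f) = mulOp T A (expOp T κ w f) := by
  apply Lp.ext
  filter_upwards [expOp_ae w (mulOp T A f), expOp_ae w f, mulOp_ae A f,
    mulOp_ae A (expOp T κ w f)] with t h1 h2 h3 h4
  rw [h1, h3, h4, h2, map_smul]

lemma wNorm_eq (w : ℝ) (f : L2 T ι) : wNorm w f = ‖expOp T ι w f‖ := by
  rw [wNorm, @norm_eq_sqrt_real_inner, L2.inner_def]
  congr 1
  apply integral_congr_ae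
  filter_upwards [expOp_ae w f] with t h
  rw [h, real_inner_self_eq_norm_sq, norm_smul, mul_pow, Real.norm_of_nonneg (Real.exp_pos _).le,
    ← Real.exp_nat_mul]
  congr 2
  push_cast
  ring

lemma norm_expOp_le {w : ℝ} (hw : 0 ≤ w) (f : L2 T ι) : ‖expOp T ι w f‖ ≤ ‖f‖ := by
  apply Lp.norm_le_norm_of_ae_le
  filter_upwards [expOp_ae w f, ae_restrict_mem measurableSet_Icc] with t h ht
  rw [h, norm_smul, Real.norm_of_nonneg (Real.exp_pos _).le]
  refine mul_le_of_le_one_left (norm_nonneg _) (Real.exp_le_one_iff.2 ?_)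
  have := mul_nonneg ht.1 hw
  linarith

/-- On `[0,T]` the weight lies between `e^{-wT}` and `1`, so only this direction of the norm
comparison costs a factor. It is the source of `e^{μT}` in the final estimate. -/
lemma norm_le_expOp {w : ℝ} (hw : 0 ≤ w) (f : L2 T ι) :
    ‖f‖ ≤ Real.exp (w * T) * ‖expOp T ι w f‖ := by
  apply Lp.norm_le_mul_norm_of_ae_le_mul
  filter_upwards [expOp_ae w f, ae_restrict_mem measurableSet_Icc] with t h ht
  rw [h, norm_smul, Real.norm_of_nonneg (Real.exp_pos _).le, ← mul_assoc, ← Real.exp_add]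
  refine le_mul_of_one_le_left (norm_nonneg _) (Real.one_le_exp ?_)
  nlinarith [ht.2]

lemma tendsto_of_expOp {w : ℝ} (hw : 0 ≤ w) {f : ℕ → L2 T ι} {g : L2 T ι}
    (h : Tendsto (fun k => ‖expOp T ι w (f k - g)‖) atTop (𝓝 0)) : Tendsto f atTop (𝓝 g) := by
  rw [tendsto_iff_norm_sub_tendsto_zero]
  refine squeeze_zero (fun _ => norm_nonneg _) (fun k => norm_le_expOp hw _) ?_
  simpa using h.const_mul (Real.exp (w * T))

end Weight

/-! ### The Volterra operator and its weighted monotonicity. -/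

section Volterra

variable {T : ℝ} {ι κ : Type} [Fintype ι] [Fintype κ] [DecidableEq κ]

lemma integrable_L2 (f : L2 T ι) : Integrable f (volume.restrict (Set.Icc (0 : ℝ) T)) :=
  (Lp.memLp f).integrable (by norm_num)

lemma intervalIntegrable_L2 (f : L2 T ι) (a b : ℝ) :
    IntervalIntegrable f (volume.restrict (Set.Icc (0 : ℝ) T)) a b :=
  (integrable_L2 f).intervalIntegrable

/-- The primitive of an `L²` function that vanishes at `0`. -/
def primitive (f : L2 T ι) (t : ℝ) : EuclideanSpace ℝ ι :=
  ∫ s in (0 : ℝ)..t, f s ∂(volume.restrict (Set.Icc (0 : ℝ) T))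

lemma continuous_primitive_L2 (f : L2 T ι) : Continuous (primitive f) :=
  intervalIntegral.continuous_primitive (intervalIntegrable_L2 f) 0

lemma integral_norm_L2_le (f : L2 T ι) :
    ∫ s in Set.Icc 0 T, ‖f s‖ ≤
      (volume.restrict (Set.Icc (0 : ℝ) T)).real Set.univ ^ (2⁻¹ : ℝ) * ‖f‖ := by
  have h := eLpNorm_le_eLpNorm_mul_rpow_measure_univ (p := 1) (q := 2) (by norm_num)
    (Lp.aestronglyMeasurable f)
  rw [integral_norm_eq_lintegral_enorm (Lp.aestronglyMeasurable f), ← eLpNorm_one_eq_lintegral_enorm,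
    Lp.norm_def, mul_comm, Measure.real, ENNReal.toReal_rpow, ← ENNReal.toReal_mul]
  refine ENNReal.toReal_mono ?_ (h.trans (le_of_eq ?_))
  · exact ENNReal.mul_ne_top (Lp.eLpNorm_ne_top f)
      (ENNReal.rpow_ne_top_of_nonneg (by norm_num) (measure_ne_top _ _))
  · norm_num

lemma norm_primitive_le (f : L2 T ι) (t : ℝ) : ‖primitive f t‖ ≤
    (volume.restrict (Set.Icc (0 : ℝ) T)).real Set.univ ^ (2⁻¹ : ℝ) * ‖f‖ := by
  refine (intervalIntegral.norm_integral_le_integral_norm_uIoc).trans ?_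
  refine (setIntegral_le_integral (integrable_L2 f).norm ?_).trans (integral_norm_L2_le f)
  exact Eventually.of_forall fun _ => norm_nonneg _

lemma memLp_primitive (f : L2 T ι) :
    MemLp (primitive f) 2 (volume.restrict (Set.Icc (0 : ℝ) T)) :=
  MemLp.of_bound (continuous_primitive_L2 f).aestronglyMeasurable _
    (Eventually.of_forall (norm_primitive_le f))

/-- The Volterra operator `f ↦ (t ↦ ∫₀ᵗ f)`. -/
def volterra (T : ℝ) (ι : Type) [Fintype ι] : L2 T ι →L[ℝ] L2 T ι :=
  LinearMap.mkContinuous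
    { toFun := fun f => (memLp_primitive f).toLp _
      map_add' := fun f g => by
        rw [← MemLp.toLp_add]
        apply MemLp.toLp_congr
        refine Eventually.of_forall fun t => ?_
        simp only [primitive, Pi.add_apply]
        rw [← intervalIntegral.integral_add (intervalIntegrable_L2 f _ _)
          (intervalIntegrable_L2 g _ _)]
        apply intervalIntegral.integral_congr_ae
        filter_upwards [Lp.coeFn_add f g] with s hs _ using hs
      map_smul' := fun c f => by
        rw [RingHom.id_apply, ← MemLp.toLp_const_smul]
        apply MemLp.toLp_congr
        refine Eventually.of_forall fun t => ?_
        simp only [primitive, Pi.smul_apply]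
        rw [← intervalIntegral.integral_smul]
        apply intervalIntegral.integral_congr_ae
        filter_upwards [Lp.coeFn_smul c f] with s hs _ using hs }
    ((volume.restrict (Set.Icc (0 : ℝ) T)).real Set.univ ^ (2⁻¹ : ℝ) *
      (volume.restrict (Set.Icc (0 : ℝ) T)).real Set.univ ^ (2⁻¹ : ℝ)) (fun f => by
      rw [mul_assoc]
      refine (Lp.norm_le_of_ae_bound (C := (volume.restrict (Set.Icc (0 : ℝ) T)).real
        Set.univ ^ (2⁻¹ : ℝ) * ‖f‖) (by positivity) ?_).trans (le_of_eq ?_)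
      swap
      · rw [ENNReal.toReal_ofNat]
        rfl
      filter_upwards [(memLp_primitive f).coeFn_toLp] with t ht
      change ‖(memLp_primitive f).toLp _ t‖ ≤ _
      rw [ht]
      exact norm_primitive_le f t)

lemma volterra_ae (f : L2 T ι) : ∀ᵐ t ∂(volume.restrict (Set.Icc (0 : ℝ) T)),
    volterra T ι f t = primitive f t :=
  (memLp_primitive f).coeFn_toLp

lemma volterra_mulOp (A : Matrix ι κ ℝ) (f : L2 T κ) :
    volterra T ι (mulOp T A f) = mulOp T A (volterra T κ f) := by
  apply Lp.ext
  filter_upwards [volterra_ae (mulOp T A f), volterra_ae f,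
    mulOp_ae A (volterra T κ f)] with t h1 h2 h4
  rw [h1, h4, h2, primitive, primitive,
    ← ContinuousLinearMap.intervalIntegral_comp_comm _ (intervalIntegrable_L2 f _ _)]
  apply intervalIntegral.integral_congr_ae
  filter_upwards [mulOp_ae A f] with s hs _ using hs

/-- The class of a bounded continuous function. -/
def ofBCF (T : ℝ) (ι : Type) [Fintype ι] :
    (ℝ →ᵇ EuclideanSpace ℝ ι) →L[ℝ] L2 T ι :=
  BoundedContinuousFunction.toLp 2 (volume.restrict (Set.Icc (0 : ℝ) T)) ℝ

lemma denseRange_ofBCF : DenseRange (ofBCF T ι) :=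
  BoundedContinuousFunction.toLp_denseRange _ _ _ (by norm_num)

lemma ofBCF_ae (h : ℝ →ᵇ EuclideanSpace ℝ ι) : ∀ᵐ t ∂(volume.restrict (Set.Icc (0 : ℝ) T)),
    ofBCF T ι h t = h t :=
  BoundedContinuousFunction.coeFn_toLp _ _ _ h

lemma primitive_ofBCF (h : ℝ →ᵇ EuclideanSpace ℝ ι) {t : ℝ} (ht : t ∈ Set.Icc 0 T) :
    primitive (ofBCF T ι h) t = ∫ s in (0 : ℝ)..t, h s := by
  rw [primitive, intervalIntegral.integral_congr_ae (g := h)]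
  · rw [intervalIntegral.integral_of_le ht.1, intervalIntegral.integral_of_le ht.1,
      Measure.restrict_restrict measurableSet_Ioc, Set.inter_eq_left.2]
    exact fun s hs => ⟨hs.1.le, hs.2.trans ht.2⟩
  · filter_upwards [ofBCF_ae (T := T) h] with s hs _ using hs

/-- Monotonicity of the derivative in exponentially weighted spaces. -/
lemma inner_volterra_ge (hT : 0 ≤ T) (w : ℝ) (h : L2 T ι) :
    w * ‖expOp T ι w (volterra T ι h)‖ ^ 2 ≤
      ⟪expOp T ι w h, expOp T ι w (volterra T ι h)⟫_ℝ := by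
  -- Both sides are continuous in `h`, so it suffices to treat continuous functions, whose
  -- primitives are classically differentiable.
  induction h using denseRange_ofBCF.induction_on with
  | hp => exact isClosed_le (by fun_prop) (by fun_prop)
  | ih h =>
    set y : ℝ → EuclideanSpace ℝ ι := fun t => ∫ s in (0 : ℝ)..t, h s with hy
    have hyd : ∀ t, HasDerivAt y (h t) t := fun t =>
      (h.continuous.integral_hasStrictDerivAt 0 t).hasDerivAt
    have hyc : Continuous y := continuous_iff_continuousAt.2 fun t => (hyd t).continuousAt
    -- The integrand of the difference of the two sides is the derivative of half the weighted
    -- energy. Since `y 0 = 0`, only the nonnegative value at `T` remains.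
    have hG : ∀ t, HasDerivAt (fun t => 2⁻¹ * (Real.exp (-(t * (2 * w))) * ⟪y t, y t⟫_ℝ))
        (Real.exp (-(t * (2 * w))) * (⟪h t, y t⟫_ℝ - w * ⟪y t, y t⟫_ℝ)) t := by
      intro t
      have h1 : HasDerivAt (fun t : ℝ => Real.exp (-(t * (2 * w))))
          (Real.exp (-(t * (2 * w))) * (-(1 * (2 * w)))) t :=
        ((hasDerivAt_id t).mul_const (2 * w)).neg.exp
      have h2 := (h1.mul ((hyd t).inner ℝ (hyd t))).const_mul (2⁻¹ : ℝ)
      refine h2.congr_deriv ?_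
      rw [real_inner_comm (h t) (y t)]
      ring
    have hG' : Continuous fun t =>
        Real.exp (-(t * (2 * w))) * (⟪h t, y t⟫_ℝ - w * ⟪y t, y t⟫_ℝ) := by
      have := h.continuous
      fun_prop
    have hint := intervalIntegral.integral_eq_sub_of_hasDerivAt (a := 0) (b := T)
      (fun t _ => hG t) (hG'.intervalIntegrable _ _)
    have hV : ∀ᵐ t ∂(volume.restrict (Set.Icc (0 : ℝ) T)),
        volterra T ι (ofBCF T ι h) t = y t := by
      filter_upwards [volterra_ae (ofBCF T ι h), ae_restrict_mem measurableSet_Icc] with t h1 h2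
      rw [h1, primitive_ofBCF h h2]
    have key : ⟪expOp T ι w (ofBCF T ι h) - w • expOp T ι w (volterra T ι (ofBCF T ι h)),
        expOp T ι w (volterra T ι (ofBCF T ι h))⟫_ℝ =
        ∫ t in (0 : ℝ)..T, Real.exp (-(t * (2 * w))) * (⟪h t, y t⟫_ℝ - w * ⟪y t, y t⟫_ℝ) := by
      rw [L2.inner_def, intervalIntegral.integral_of_le hT, ← integral_Icc_eq_integral_Ioc]
      apply integral_congr_ae
      filter_upwards [hV, ofBCF_ae h, expOp_ae w (ofBCF T ι h),
        expOp_ae w (volterra T ι (ofBCF T ι h)),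
        Lp.coeFn_sub (expOp T ι w (ofBCF T ι h)) (w • expOp T ι w (volterra T ι (ofBCF T ι h))),
        Lp.coeFn_smul w (expOp T ι w (volterra T ι (ofBCF T ι h)))] with t h1 h2 h3 h4 h5 h6
      rw [h5, Pi.sub_apply, h6, Pi.smul_apply, h3, h4, h1, h2,
        show -(t * (2 * w)) = -(t * w) + -(t * w) by ring, Real.exp_add]
      simp only [inner_sub_left, inner_smul_left, inner_smul_right, RCLike.conj_to_real]
      ring
    rw [hint, inner_sub_left, inner_smul_left, real_inner_self_eq_norm_sq] at key
    have h0 : y 0 = 0 := by simp [hy]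
    have h1 : 0 ≤ 2⁻¹ * (Real.exp (-(T * (2 * w))) * ⟪y T, y T⟫_ℝ) :=
      mul_nonneg (by norm_num) (mul_nonneg (Real.exp_pos _).le real_inner_self_nonneg)
    simp only [h0, inner_zero_left, mul_zero, sub_zero, RCLike.conj_to_real] at key
    linarith

end Volterra

/-! ### Weak derivatives and the representation of `H¹` functions as primitives. -/

section WeakDeriv

variable {T : ℝ} {ι : Type} [Fintype ι]

lemma exists_bound_Icc (T : ℝ) (c : C(ℝ, ℝ)) : ∃ C, ∀ t ∈ Set.Icc 0 T, ‖c t‖ ≤ C :=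
  isCompact_Icc.exists_bound_of_continuousOn c.continuous.continuousOn

lemma integrable_smul_L2 (c : C(ℝ, ℝ)) (f : L2 T ι) :
    Integrable (fun t => c t • f t) (volume.restrict (Set.Icc (0 : ℝ) T)) := by
  obtain ⟨C, hC⟩ := exists_bound_Icc T c
  refine ((integrable_L2 f).norm.const_mul C).mono'
    (c.continuous.aestronglyMeasurable.smul (Lp.aestronglyMeasurable f)) ?_
  filter_upwards [ae_restrict_mem measurableSet_Icc] with t ht
  rw [norm_smul]
  exact mul_le_mul_of_nonneg_right (hC t ht) (norm_nonneg _)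

/-- Integration over `[0,T]` against a continuous weight. -/
def pairing (T : ℝ) (ι : Type) [Fintype ι] (c : C(ℝ, ℝ)) : L2 T ι →L[ℝ] EuclideanSpace ℝ ι :=
  LinearMap.mkContinuousOfExistsBound
    { toFun := fun f => ∫ t in Set.Icc 0 T, c t • f t
      map_add' := fun f g => by
        rw [← integral_add (integrable_smul_L2 c f) (integrable_smul_L2 c g)]
        apply integral_congr_ae
        filter_upwards [Lp.coeFn_add f g] with t ht
        rw [ht, Pi.add_apply, smul_add]
      map_smul' := fun a f => by
        rw [RingHom.id_apply, ← integral_smul]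
        apply integral_congr_ae
        filter_upwards [Lp.coeFn_smul a f] with t ht
        rw [ht, Pi.smul_apply, smul_comm] }
    (by
      obtain ⟨C, hC⟩ := exists_bound_Icc T c
      refine ⟨|C| * (volume.restrict (Set.Icc (0 : ℝ) T)).real Set.univ ^ (2⁻¹ : ℝ), fun f => ?_⟩
      rw [mul_assoc]
      refine le_trans ?_ (mul_le_mul_of_nonneg_left (integral_norm_L2_le f) (abs_nonneg C))
      rw [← integral_const_mul]
      refine norm_integral_le_of_norm_le ((integrable_L2 f).norm.const_mul _) ?_
      filter_upwards [ae_restrict_mem measurableSet_Icc] with t ht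
      rw [norm_smul]
      exact mul_le_mul_of_nonneg_right ((hC t ht).trans (le_abs_self C)) (norm_nonneg _))

lemma pairing_apply (c : C(ℝ, ℝ)) (f : L2 T ι) :
    pairing T ι c f = ∫ t in Set.Icc 0 T, c t • f t := rfl

lemma pairing_sub_smul (c d : C(ℝ, ℝ)) (a : ℝ) (f : L2 T ι) :
    pairing T ι (c - a • d) f = pairing T ι c f - a • pairing T ι d f := by
  have h : a • pairing T ι d f = pairing T ι (a • d) f := by
    rw [pairing_apply, pairing_apply, ← integral_smul]
    simp [mul_smul]
  rw [h, pairing_apply, pairing_apply, pairing_apply,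
    ← integral_sub (integrable_smul_L2 c f) (integrable_smul_L2 (a • d) f)]
  simp [sub_smul]

/-- A smooth function as a continuous map. -/
def smoothMap (φ : ℝ → ℝ) (h : ContDiff ℝ ∞ φ) : C(ℝ, ℝ) := ⟨φ, h.continuous⟩

/-- The derivative of a smooth function as a continuous map. -/
def smoothDerivMap (φ : ℝ → ℝ) (h : ContDiff ℝ ∞ φ) : C(ℝ, ℝ) :=
  ⟨deriv φ, h.continuous_deriv (by simp)⟩

lemma isWeakDeriv_iff {f g : L2 T ι} : IsWeakDeriv f g ↔
    ∀ (φ : ℝ → ℝ) (h : ContDiff ℝ ∞ φ), HasCompactSupport φ → tsupport φ ⊆ Set.Ioo 0 T →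
      pairing T ι (smoothDerivMap φ h) f = - pairing T ι (smoothMap φ h) g := Iff.rfl

lemma IsWeakDeriv.add {f g f' g' : L2 T ι} (h : IsWeakDeriv f g) (h' : IsWeakDeriv f' g') :
    IsWeakDeriv (f + f') (g + g') := by
  rw [isWeakDeriv_iff] at *
  intro φ h1 h2 h3
  rw [map_add, map_add, h φ h1 h2 h3, h' φ h1 h2 h3, neg_add]

lemma IsWeakDeriv.sub {f g f' g' : L2 T ι} (h : IsWeakDeriv f g) (h' : IsWeakDeriv f' g') :
    IsWeakDeriv (f - f') (g - g') := by
  rw [isWeakDeriv_iff] at *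
  intro φ h1 h2 h3
  rw [map_sub, map_sub, h φ h1 h2 h3, h' φ h1 h2 h3]
  abel

lemma eq_zero_of_notMem_tsupport_subset {φ : ℝ → ℝ} {s : Set ℝ} (h : tsupport φ ⊆ s) {t : ℝ}
    (ht : t ∉ s) : φ t = 0 :=
  image_eq_zero_of_notMem_tsupport fun h' => ht (h h')

lemma isWeakDeriv_volterra (hT : 0 ≤ T) (g : L2 T ι) : IsWeakDeriv (volterra T ι g) g := by
  rw [isWeakDeriv_iff]
  intro φ h1 h2 h3
  induction g using denseRange_ofBCF.induction_on with
  | hp => exact isClosed_eq (by fun_prop) (by fun_prop)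
  | ih h =>
    set y : ℝ → EuclideanSpace ℝ ι := fun t => ∫ s in (0 : ℝ)..t, h s with hy
    have hyd : ∀ t, HasDerivAt y (h t) t := fun t =>
      (h.continuous.integral_hasStrictDerivAt 0 t).hasDerivAt
    have hyc : Continuous y := continuous_iff_continuousAt.2 fun t => (hyd t).continuousAt
    have hd : ∀ t, HasDerivAt (fun t => φ t • y t) (φ t • h t + deriv φ t • y t) t := fun t =>
      ((h1.differentiable (by simp)).differentiableAt.hasDerivAt).smul (hyd t)
    have hdc : Continuous fun t => φ t • h t + deriv φ t • y t := by
      have := h.continuous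
      have := h1.continuous
      have := h1.continuous_deriv (by simp)
      fun_prop
    have hint := intervalIntegral.integral_eq_sub_of_hasDerivAt (a := 0) (b := T)
      (fun t _ => hd t) (hdc.intervalIntegrable _ _)
    rw [eq_zero_of_notMem_tsupport_subset h3 (t := T) (by simp),
      eq_zero_of_notMem_tsupport_subset h3 (t := 0) (by simp), zero_smul, zero_smul, sub_zero,
      intervalIntegral.integral_of_le hT, ← integral_Icc_eq_integral_Ioc] at hint
    rw [eq_neg_iff_add_eq_zero, pairing_apply, pairing_apply,
      ← integral_add (integrable_smul_L2 _ _) (integrable_smul_L2 _ _), ← hint]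
    apply integral_congr_ae
    filter_upwards [volterra_ae (ofBCF T ι h), ofBCF_ae h, ae_restrict_mem measurableSet_Icc]
      with t e1 e2 e3
    rw [e1, e2, primitive_ofBCF h e3, add_comm]
    rfl

lemma isWeakDeriv_constOp (hT : 0 ≤ T) (c : EuclideanSpace ℝ ι) :
    IsWeakDeriv (constOp T ι c) 0 := by
  rw [isWeakDeriv_iff]
  intro φ h1 h2 h3
  have hint := intervalIntegral.integral_eq_sub_of_hasDerivAt (a := 0) (b := T)
    (fun t _ => (h1.differentiable (by simp)).differentiableAt.hasDerivAt)
    ((h1.continuous_deriv (by simp)).intervalIntegrable _ _)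
  rw [eq_zero_of_notMem_tsupport_subset h3 (t := T) (by simp),
    eq_zero_of_notMem_tsupport_subset h3 (t := 0) (by simp), sub_zero,
    intervalIntegral.integral_of_le hT, ← integral_Icc_eq_integral_Ioc] at hint
  rw [map_zero, neg_zero, pairing_apply]
  calc _ = ∫ t in Set.Icc 0 T, deriv φ t • c := by
        apply integral_congr_ae
        filter_upwards [constOp_ae (T := T) c] with t e1
        rw [e1]
        rfl
    _ = 0 := by rw [integral_smul_const, hint, zero_smul]

lemma eq_zero_of_forall_pairing {g : L2 T ι}
    (h : ∀ (φ : ℝ → ℝ) (h : ContDiff ℝ ∞ φ), HasCompactSupport φ → tsupport φ ⊆ Set.Ioo 0 T →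
      pairing T ι (smoothMap φ h) g = 0) : g = 0 := by
  have := isOpen_Ioo.ae_eq_zero_of_integral_contDiff_smul_eq_zero
    (μ := volume.restrict (Set.Icc (0 : ℝ) T)) (U := Set.Ioo 0 T) (f := g)
    ((integrable_L2 g).locallyIntegrable.locallyIntegrableOn _) (fun φ h1 h2 h3 => h φ h1 h2 h3)
  apply Lp.ext
  have h2 : ∀ᵐ t ∂(volume.restrict (Set.Icc (0 : ℝ) T)), t ∈ Set.Ioo 0 T := by
    rw [← Measure.restrict_congr_set Ioo_ae_eq_Icc]
    exact ae_restrict_mem measurableSet_Ioo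
  filter_upwards [this, h2, Lp.coeFn_zero (EuclideanSpace ℝ ι) 2
    (volume.restrict (Set.Icc (0 : ℝ) T))] with t e1 e2 e3
  rw [e1 e2, e3, Pi.zero_apply]

lemma IsWeakDeriv.unique {f g g' : L2 T ι} (h : IsWeakDeriv f g) (h' : IsWeakDeriv f g') :
    g = g' := by
  rw [← sub_eq_zero]
  refine eq_zero_of_forall_pairing fun φ h1 h2 h3 => ?_
  have := isWeakDeriv_iff.1 (h.sub h') φ h1 h2 h3
  rw [sub_self, map_zero] at this
  rw [← neg_eq_zero, ← this]

lemma IsWeakDeriv.weakDeriv_eq {f g : L2 T ι} (h : IsWeakDeriv f g) : weakDeriv f = g := by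
  have hex : ∃ g, IsWeakDeriv f g := ⟨g, h⟩
  rw [weakDeriv, dif_pos hex]
  exact hex.choose_spec.unique h

lemma volterra_injective (hT : 0 ≤ T) : Function.Injective (volterra T ι) := fun g g' h =>
  (isWeakDeriv_volterra hT g).unique (h ▸ isWeakDeriv_volterra hT g')

/-- A test function with integral zero is the derivative of a test function. -/
lemma exists_test_primitive {χ : ℝ → ℝ} (h1 : ContDiff ℝ ∞ χ) (h2 : HasCompactSupport χ)
    (h3 : tsupport χ ⊆ Set.Ioo 0 T) (h4 : ∫ t, χ t = 0) :
    ∃ Φ : ℝ → ℝ, ContDiff ℝ ∞ Φ ∧ HasCompactSupport Φ ∧ tsupport Φ ⊆ Set.Ioo 0 T ∧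
      deriv Φ = χ := by
  rcases (tsupport χ).eq_empty_or_nonempty with he | hne
  · have h0 : χ = 0 := tsupport_eq_empty_iff.1 he
    refine ⟨0, contDiff_const, HasCompactSupport.zero, ?_, ?_⟩
    · rw [tsupport_eq_empty_iff.2 rfl]; exact Set.empty_subset _
    · rw [h0]; funext t; simp
  obtain ⟨a, ha, ha'⟩ := h2.isCompact.exists_isLeast hne
  obtain ⟨b, hb, hb'⟩ := h2.isCompact.exists_isGreatest hne
  have hd : ∀ t, HasDerivAt (fun t => ∫ s in (0 : ℝ)..t, χ s) (χ t) t := fun t =>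
    (h1.continuous.integral_hasStrictDerivAt 0 t).hasDerivAt
  have hder : deriv (fun t => ∫ s in (0 : ℝ)..t, χ s) = χ := funext fun t => (hd t).deriv
  have hsupp : Function.support (fun t => ∫ s in (0 : ℝ)..t, χ s) ⊆ Set.Icc a b := by
    intro t ht
    by_contra hcon
    apply ht
    by_cases hta : a ≤ t
    -- To the right of the support the primitive equals the full integral, which is zero by `h4`.
    · have htb : b < t := not_le.1 fun h => hcon ⟨hta, h⟩
      change (∫ s in (0 : ℝ)..t, χ s) = 0
      rw [intervalIntegral.integral_eq_integral_of_support_subset, h4]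
      intro s hs
      have hs' := subset_tsupport χ hs
      exact ⟨(h3 hs').1, (hb' hs').trans htb.le⟩
    · push Not at hta
      change (∫ s in (0 : ℝ)..t, χ s) = 0
      rw [intervalIntegral.integral_congr (g := fun _ => 0)]
      · simp
      · intro s hs
        apply image_eq_zero_of_notMem_tsupport
        intro hs'
        have h5 := (h3 ha).1
        have h6 := hs.2
        have h7 := ha' hs'
        rcases le_max_iff.1 h6 with h | h <;> linarith
  refine ⟨fun t => ∫ s in (0 : ℝ)..t, χ s, ?_,
    HasCompactSupport.of_support_subset_isCompact isCompact_Icc hsupp, ?_, hder⟩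
  · rw [contDiff_infty_iff_deriv, hder]
    exact ⟨fun t => (hd t).differentiableAt, h1⟩
  · exact (closure_minimal hsupp isClosed_Icc).trans (Set.Icc_subset_Ioo (h3 ha).1 (h3 hb).2)

lemma integral_eq_setIntegral_of_tsupport {φ : ℝ → ℝ} (h : tsupport φ ⊆ Set.Ioo 0 T) :
    ∫ t in Set.Icc 0 T, φ t = ∫ t, φ t :=
  setIntegral_eq_integral_of_forall_compl_eq_zero fun _ ht =>
    eq_zero_of_notMem_tsupport_subset h fun h' => ht (Set.Ioo_subset_Icc_self h')

/-- The lemma of du Bois-Reymond. -/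
lemma IsWeakDeriv.eq_constOp (hT : 0 < T) {f : L2 T ι} (h : IsWeakDeriv f 0) :
    ∃ c, f = constOp T ι c := by
  rw [isWeakDeriv_iff] at h
  let β : ContDiffBump (T / 2) := ⟨T / 8, T / 4, by positivity, by linarith⟩
  have b1 : ContDiff ℝ ∞ (β.normed volume) := β.contDiff_normed
  have b2 : HasCompactSupport (β.normed volume) := β.hasCompactSupport_normed
  have b3 : tsupport (β.normed volume) ⊆ Set.Ioo 0 T := by
    rw [β.tsupport_normed_eq, Real.closedBall_eq_Icc]
    apply Set.Icc_subset_Ioo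
    · change 0 < T / 2 - T / 4; linarith
    · change T / 2 + T / 4 < T; linarith
  refine ⟨pairing T ι (smoothMap _ b1) f, ?_⟩
  rw [← sub_eq_zero]
  refine eq_zero_of_forall_pairing fun φ h1 h2 h3 => ?_
  set a := ∫ t, φ t with ha
  -- Subtracting its integral times a bump of integral one leaves a test function of mean zero. This
  -- is the derivative of a test function, so `f` annihilates it; hence `f` pairs with `φ` as the
  -- constant given by its pairing with the bump.
  have c1 : ContDiff ℝ ∞ (fun t => φ t - a * β.normed volume t) :=
    h1.sub (contDiff_const.mul b1)
  have csub : tsupport (fun t => φ t - a * β.normed volume t) ⊆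
      tsupport φ ∪ tsupport (β.normed volume) := by
    refine closure_minimal (fun t ht => ?_) ((isClosed_tsupport _).union (isClosed_tsupport _))
    by_contra hcon
    rw [Set.mem_union, not_or] at hcon
    apply ht
    change φ t - a * β.normed volume t = 0
    rw [image_eq_zero_of_notMem_tsupport hcon.1, image_eq_zero_of_notMem_tsupport hcon.2]
    ring
  have c3 : tsupport (fun t => φ t - a * β.normed volume t) ⊆ Set.Ioo 0 T :=
    csub.trans (Set.union_subset h3 b3)
  have c2 : HasCompactSupport (fun t => φ t - a * β.normed volume t) :=
    (h2.isCompact.union b2.isCompact).of_isClosed_subset (isClosed_tsupport _) csub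
  have c4 : ∫ t, (φ t - a * β.normed volume t) = 0 := by
    rw [integral_sub (h1.continuous.integrable_of_hasCompactSupport h2)
      ((b1.continuous.integrable_of_hasCompactSupport b2).const_mul a), integral_const_mul,
      β.integral_normed]
    ring
  obtain ⟨Φ, p1, p2, p3, p4⟩ := exists_test_primitive c1 c2 c3 c4
  have key := h Φ p1 p2 p3
  rw [map_zero, neg_zero] at key
  have e1 : smoothDerivMap Φ p1 = smoothMap φ h1 - a • smoothMap _ b1 := by
    ext t
    exact congrFun p4 t
  have e2 : pairing T ι (smoothMap φ h1) f = a • pairing T ι (smoothMap _ b1) f := by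
    rw [← sub_eq_zero, ← key, e1, pairing_sub_smul]
  have e3 : ∀ c, pairing T ι (smoothMap φ h1) (constOp T ι c) = a • c := by
    intro c
    rw [pairing_apply, ha, ← integral_eq_setIntegral_of_tsupport h3, ← integral_smul_const]
    apply integral_congr_ae
    filter_upwards [constOp_ae (T := T) c] with t e
    rw [e]
    rfl
  rw [map_sub, e2, e3, sub_self]

/-- The constant from `eq_constOp` is identified by evaluating at `0`: two functions continuous on
`[0,T]` that agree almost everywhere agree everywhere there. Membership in the domain of `M` thereby
becomes an integral equation. -/
lemma IsWeakDeriv.eq_constOp_add_volterra (hT : 0 < T) {f g : L2 T ι} (h : IsWeakDeriv f g)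
    {c : EuclideanSpace ℝ ι} (hc : HasInitialValue f c) :
    f = constOp T ι c + volterra T ι g := by
  have h0 := h.sub (isWeakDeriv_volterra hT.le g)
  rw [sub_self] at h0
  obtain ⟨c', hc'⟩ := h0.eq_constOp hT
  obtain ⟨F, F1, F2, F3⟩ := hc
  have hf : f = constOp T ι c' + volterra T ι g := by rw [← hc', sub_add_cancel]
  have hae : F =ᵐ[volume.restrict (Set.Icc (0 : ℝ) T)] fun t => c' + primitive g t := by
    filter_upwards [F2, constOp_ae (T := T) c', volterra_ae g,
      Lp.coeFn_add (constOp T ι c') (volterra T ι g)] with t e1 e2 e3 e4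
    rw [← e1, hf, e4, Pi.add_apply, e2, e3]
  have := Measure.eqOn_Icc_of_ae_eq volume hT.ne hae F1
    (continuous_const.add (continuous_primitive_L2 g)).continuousOn
    (Set.left_mem_Icc.2 hT.le)
  simp only [F3, primitive, intervalIntegral.integral_same, add_zero] at this
  rw [this]
  exact hf

lemma isWeakDeriv_constOp_add_volterra (hT : 0 ≤ T) (c : EuclideanSpace ℝ ι) (g : L2 T ι) :
    IsWeakDeriv (constOp T ι c + volterra T ι g) g := by
  simpa using (isWeakDeriv_constOp hT c).add (isWeakDeriv_volterra hT g)

lemma hasInitialValue_constOp_add_volterra (c : EuclideanSpace ℝ ι) (g : L2 T ι) :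
    HasInitialValue (constOp T ι c + volterra T ι g) c := by
  refine ⟨fun t => c + primitive g t,
    (continuous_const.add (continuous_primitive_L2 g)).continuousOn, ?_, by simp [primitive]⟩
  filter_upwards [constOp_ae (T := T) c, volterra_ae g,
    Lp.coeFn_add (constOp T ι c) (volterra T ι g)] with t e2 e3 e4
  rw [e4, Pi.add_apply, e2, e3]

end WeakDeriv

/-! ### Volterra equations of the second kind. -/

section VolterraEquation

variable {T : ℝ} {ι : Type} [Fintype ι]

/-- Cauchy–Schwarz applied to `inner_volterra_ge`: a large weight makes integration a small
operator. -/
lemma mul_norm_expOp_volterra_le (hT : 0 ≤ T) (w : ℝ) (h : L2 T ι) :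
    w * ‖expOp T ι w (volterra T ι h)‖ ≤ ‖expOp T ι w h‖ := by
  have h1 := (inner_volterra_ge hT w h).trans (real_inner_le_norm _ _)
  rcases (norm_nonneg (expOp T ι w (volterra T ι h))).eq_or_lt' with h0 | h0
  · rw [h0, mul_zero]; exact norm_nonneg _
  · refine le_of_mul_le_mul_right ?_ h0
    nlinarith

/-- Linear Volterra equations of the second kind are solvable. -/
lemma exists_volterra_solution [DecidableEq ι] (hT : 0 ≤ T) (C : Matrix ι ι ℝ) (r : L2 T ι) :
    ∃ v, v - volterra T ι (mulOp T C v) = r := by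
  set K : L2 T ι →L[ℝ] L2 T ι := (volterra T ι) ∘L (mulOp T C) with hK
  -- With this weight `K` contracts by one half; the summand `1` keeps `w` positive when `C = 0`.
  set w : ℝ := 2 * specNorm C + 1 with hw
  have hC : 0 ≤ specNorm C := norm_nonneg _
  have hw0 : 0 < w := by positivity
  have h1 : ∀ f, ‖expOp T ι w (K f)‖ ≤ 2⁻¹ * ‖expOp T ι w f‖ := by
    intro f
    have h2 := mul_norm_expOp_volterra_le hT w (mulOp T C f)
    rw [expOp_mulOp] at h2
    have h3 := h2.trans (norm_mulOp_le C (expOp T ι w f))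
    change ‖expOp T ι w (volterra T ι (mulOp T C f))‖ ≤ _
    refine le_of_mul_le_mul_left (h3.trans ?_) hw0
    have := norm_nonneg (expOp T ι w f)
    rw [hw]
    nlinarith
  have h2 : ∀ (k : ℕ) f, ‖expOp T ι w ((K ^ k) f)‖ ≤ 2⁻¹ ^ k * ‖expOp T ι w f‖ := by
    intro k
    induction k with
    | zero => intro f; simp
    | succ k ih =>
      intro f
      rw [pow_succ', pow_succ', mul_assoc]
      exact (h1 _).trans (mul_le_mul_of_nonneg_left (ih f) (by norm_num))
  -- Returning to the unweighted norm costs `e^{wT}` only once, so a high power of `K` has norm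
  -- below one.
  obtain ⟨k, hk⟩ := exists_pow_lt_of_lt_one (inv_pos.2 (Real.exp_pos (w * T)))
    (by norm_num : (2⁻¹ : ℝ) < 1)
  have hn : ‖K ^ k‖ < 1 := by
    refine lt_of_le_of_lt (ContinuousLinearMap.opNorm_le_bound (M := Real.exp (w * T) * 2⁻¹ ^ k) _
      (by positivity) fun f => ?_) ?_
    · refine (norm_le_expOp hw0.le _).trans ?_
      rw [mul_assoc]
      exact mul_le_mul_of_nonneg_left ((h2 k f).trans
        (mul_le_mul_of_nonneg_left (norm_expOp_le hw0.le f) (by positivity)))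
        (Real.exp_pos _).le
    · have := mul_lt_mul_of_pos_left hk (Real.exp_pos (w * T))
      rwa [mul_inv_cancel₀ (Real.exp_pos _).ne'] at this
  have hu : IsUnit (1 - K ^ k) := isUnit_one_sub_of_norm_lt_one hn
  obtain ⟨G, hG⟩ := hu.exists_right_inv
  -- The geometric sum converts a right inverse of `1 - K ^ k` into one of `1 - K`.
  have hfac : 1 - K ^ k = (1 - K) * ∑ i ∈ Finset.range k, K ^ i := by
    rw [mul_neg_geom_sum]
  refine ⟨((∑ i ∈ Finset.range k, K ^ i) * G) r, ?_⟩
  rw [hfac, mul_assoc] at hG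
  exact congrArg (fun A : L2 T ι →L[ℝ] L2 T ι => A r) hG

end VolterraEquation

/-! ### Positive semidefinite and skew matrices. -/

section PosSemidef

variable {ι : Type} [Fintype ι]

lemma Matrix.PosSemidef.nonneg_of_mem_spectrum [DecidableEq ι] {P : Matrix ι ι ℝ} (hP : P.PosSemidef) {x : ℝ}
    (hx : x ∈ spectrum ℝ P) : 0 ≤ x :=
  (Matrix.posSemidef_iff_isHermitian_and_spectrum_nonneg.1 hP).2 hx

lemma Matrix.continuousOn_spectrum [DecidableEq ι] (f : ℝ → ℝ) (P : Matrix ι ι ℝ) :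
    ContinuousOn f (spectrum ℝ P) :=
  P.finite_real_spectrum.continuousOn f

lemma Matrix.transpose_cfc [DecidableEq ι] (f : ℝ → ℝ) (P : Matrix ι ι ℝ) : (cfc f P)ᵀ = cfc f P := by
  have h : star (cfc f P) = cfc f P := (cfc_predicate f P : IsSelfAdjoint _).star_eq
  rwa [Matrix.star_eq_conjTranspose, Matrix.conjTranspose_eq_transpose_of_trivial] at h

lemma Matrix.PosSemidef.exists_symm_sq [DecidableEq ι] {P : Matrix ι ι ℝ} (hP : P.PosSemidef) :
    ∃ C : Matrix ι ι ℝ, Cᵀ = C ∧ C * C = P := by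
  have hs : IsSelfAdjoint P := hP.isHermitian
  refine ⟨cfc Real.sqrt P, Matrix.transpose_cfc _ _, ?_⟩
  rw [← cfc_mul _ _ P (Matrix.continuousOn_spectrum _ P) (Matrix.continuousOn_spectrum _ P)]
  conv_rhs => rw [← cfc_id ℝ P]
  exact cfc_congr fun x hx => Real.mul_self_sqrt (hP.nonneg_of_mem_spectrum hx)

/-- A square root of the Moore-Penrose inverse of a positive semidefinite matrix. -/
lemma Matrix.PosSemidef.exists_sqrt_pinv [DecidableEq ι] {P : Matrix ι ι ℝ} (hP : P.PosSemidef) :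
    ∃ C : Matrix ι ι ℝ, Cᵀ = C ∧ P * (C * C) = (C * C) * P ∧ P * (C * C) * P = P := by
  have hs : IsSelfAdjoint P := hP.isHermitian
  have hc := fun f => Matrix.continuousOn_spectrum f P
  have hid : cfc (fun x : ℝ => x) P = P := cfc_id ℝ P
  have h1 : P * (cfc (fun x => Real.sqrt x⁻¹) P * cfc (fun x => Real.sqrt x⁻¹) P) =
      cfc (fun x : ℝ => x * (Real.sqrt x⁻¹ * Real.sqrt x⁻¹)) P := by
    rw [cfc_mul _ _ P (hc _) (hc _), cfc_mul _ _ P (hc _) (hc _), hid]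
  -- The convention `0⁻¹ = 0` makes this function vanish on the kernel of `P`, as the Moore–Penrose
  -- inverse requires.
  refine ⟨cfc (fun x => Real.sqrt x⁻¹) P, Matrix.transpose_cfc _ _, ?_, ?_⟩
  · rw [h1]
    simp_rw [mul_comm _ (Real.sqrt _ * Real.sqrt _)]
    rw [cfc_mul _ _ P (hc _) (hc _), cfc_mul _ _ P (hc _) (hc _), hid]
  · rw [h1]
    nth_rewrite 2 [← hid]
    rw [← cfc_mul _ _ P (hc _) (hc _)]
    conv_rhs => rw [← hid]
    refine cfc_congr fun x hx => ?_
    have h0 := hP.nonneg_of_mem_spectrum hx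
    change x * (Real.sqrt x⁻¹ * Real.sqrt x⁻¹) * x = x
    rw [Real.mul_self_sqrt (inv_nonneg.2 h0)]
    rcases h0.eq_or_lt with h | h
    · rw [← h]; simp
    · field_simp

lemma Matrix.PosSemidef.transpose_eq {κ : Type} {P : Matrix κ κ ℝ} (hP : P.PosSemidef) : Pᵀ = P := by
  have := hP.isHermitian
  rwa [Matrix.IsHermitian, Matrix.conjTranspose_eq_transpose_of_trivial] at this

lemma Matrix.PosSemidef.mulVec_eq_zero {P : Matrix ι ι ℝ} (hP : P.PosSemidef) {v : ι → ℝ}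
    (h : v ⬝ᵥ P *ᵥ v = 0) : P *ᵥ v = 0 :=
  (hP.dotProduct_mulVec_zero_iff v).1 (by simpa using h)

lemma Matrix.PosSemidef.dotProduct_nonneg {P : Matrix ι ι ℝ} (hP : P.PosSemidef) (v : ι → ℝ) :
    0 ≤ v ⬝ᵥ P *ᵥ v := by
  simpa using hP.dotProduct_mulVec_nonneg v

lemma Matrix.isUnit_of_forall_mulVec_eq_zero [DecidableEq ι] {A : Matrix ι ι ℝ}
    (h : ∀ v, A *ᵥ v = 0 → v = 0) : IsUnit A := by
  rw [← Matrix.mulVec_injective_iff_isUnit]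
  intro v w hvw
  rw [← sub_eq_zero]
  apply h
  rw [Matrix.mulVec_sub]
  exact sub_eq_zero.2 hvw

/-- Since `A * Aᵀ` has the rank of `A`, full row rank makes it invertible. -/
lemma Matrix.transpose_mulVec_injective_of_rank [DecidableEq ι] {κ : Type} [Fintype κ] {A : Matrix ι κ ℝ}
    (h : A.rank = Fintype.card ι) {v : ι → ℝ} (hv : Aᵀ *ᵥ v = 0) : v = 0 := by
  have h1 : LinearMap.range (A * Aᵀ).mulVecLin = ⊤ := by
    apply Submodule.eq_top_of_finrank_eq
    rw [← Matrix.rank, Matrix.rank_self_mul_transpose, h, Module.finrank_fintype_fun_eq_card]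
  have h2 : Function.Injective (A * Aᵀ).mulVec := by
    rw [Matrix.mulVec_injective_iff_isUnit, ← Matrix.mulVec_surjective_iff_isUnit]
    exact LinearMap.range_eq_top.1 h1
  apply h2
  rw [← Matrix.mulVec_mulVec, hv, Matrix.mulVec_zero, Matrix.mulVec_zero]

lemma Matrix.dotProduct_skew {A : Matrix ι ι ℝ} (h : Aᵀ = -A) (v : ι → ℝ) :
    v ⬝ᵥ A *ᵥ v = 0 := by
  have h1 : v ⬝ᵥ A *ᵥ v = v ⬝ᵥ Aᵀ *ᵥ v := by
    rw [Matrix.mulVec_transpose, dotProduct_comm v (v ᵥ* A), Matrix.dotProduct_mulVec]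
  rw [h, Matrix.neg_mulVec, dotProduct_neg] at h1
  linarith

end PosSemidef

/-! ### Quadratic forms on `L²` and solvability of index-one equations. -/

section Operators

variable {T : ℝ} {ι : Type} [Fintype ι] [DecidableEq ι]

lemma inner_mulOp_sq {C : Matrix ι ι ℝ} (hC : Cᵀ = C) (f g : L2 T ι) :
    ⟪mulOp T C f, mulOp T C g⟫_ℝ = ⟪f, mulOp T (C * C) g⟫_ℝ := by
  rw [inner_mulOp, hC, mulOp_mul_apply]

lemma inner_mulOp_nonneg {P : Matrix ι ι ℝ} (hP : P.PosSemidef) (f : L2 T ι) :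
    0 ≤ ⟪f, mulOp T P f⟫_ℝ := by
  obtain ⟨C, hC, rfl⟩ := hP.exists_symm_sq
  rw [← inner_mulOp_sq hC]
  exact real_inner_self_nonneg

lemma inner_mulOp_skew {A : Matrix ι ι ℝ} (h : Aᵀ = -A) (f : L2 T ι) :
    ⟪f, mulOp T A f⟫_ℝ = 0 := by
  have h1 := inner_mulOp A f f
  rw [h, mulOp_neg, neg_apply, inner_neg_right, real_inner_comm] at h1
  linarith

/-- Cauchy–Schwarz for the form of `S`, applied to `f` and `g = S⁻¹ f`: `‖f‖⁴ = ⟨f, Sg⟩² ≤ ⟨f,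
Sf⟩⟨g, Sg⟩`, and `⟨g, Sg⟩ = ⟨S⁻¹f, f⟩ ≤ ‖S⁻¹‖ ‖f‖²`. -/
lemma norm_sq_le_specNorm_inv_mul {S : Matrix ι ι ℝ} (hS : S.PosSemidef) (hu : IsUnit S)
    (f : L2 T ι) : ‖f‖ ^ 2 ≤ specNorm S⁻¹ * ⟪f, mulOp T S f⟫_ℝ := by
  obtain ⟨C, hC, hCS⟩ := hS.exists_symm_sq
  have hdet : IsUnit S.det := (Matrix.isUnit_iff_isUnit_det S).1 hu
  set g := mulOp T S⁻¹ f with hg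
  have hSg : mulOp T S g = f := by
    rw [hg, ← mulOp_mul_apply, Matrix.mul_nonsing_inv S hdet, mulOp_one_apply]
  have h1 : ‖f‖ ^ 2 = ⟪mulOp T C f, mulOp T C g⟫_ℝ := by
    rw [inner_mulOp_sq hC, hCS, hSg, real_inner_self_eq_norm_sq]
  have h2 : ‖mulOp T C f‖ ^ 2 = ⟪f, mulOp T S f⟫_ℝ := by
    rw [← real_inner_self_eq_norm_sq, inner_mulOp_sq hC, hCS]
  have h3 : ‖mulOp T C g‖ ^ 2 ≤ specNorm S⁻¹ * ‖f‖ ^ 2 := by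
    rw [← real_inner_self_eq_norm_sq, inner_mulOp_sq hC, hCS, hSg]
    refine (real_inner_le_norm _ _).trans ?_
    have := norm_mulOp_le S⁻¹ f
    nlinarith [norm_nonneg f]
  have h4 : ‖f‖ ^ 2 ≤ ‖mulOp T C f‖ * ‖mulOp T C g‖ := h1 ▸ real_inner_le_norm _ _
  rw [← h2]
  rcases (sq_nonneg ‖f‖).eq_or_lt with h0 | h0
  · rw [← h0]
    exact mul_nonneg (norm_nonneg _) (sq_nonneg _)
  · have h5 : ‖f‖ ^ 2 * ‖f‖ ^ 2 ≤ ‖mulOp T C f‖ ^ 2 * ‖mulOp T C g‖ ^ 2 := by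
      refine (mul_self_le_mul_self h0.le h4).trans (le_of_eq ?_)
      ring
    have h6 := h5.trans (mul_le_mul_of_nonneg_left h3 (sq_nonneg _))
    refine le_of_mul_le_mul_right (h6.trans (le_of_eq ?_)) h0
    ring

/-- Extends `inner_volterra_ge` to a singular `P` by applying it to `C g`, where `C` is a root of
the pseudoinverse; then `V(Cg) = CPd` and `⟨CPd, CPd⟩ = ⟨d, Pd⟩`. -/
lemma inner_expOp_volterra_ge (hT : 0 ≤ T) (w : ℝ) {P : Matrix ι ι ℝ} (hP : P.PosSemidef)
    {d g : L2 T ι} (h : mulOp T P d = volterra T ι g) :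
    w * ⟪expOp T ι w d, mulOp T P (expOp T ι w d)⟫_ℝ ≤ ⟪expOp T ι w g, expOp T ι w d⟫_ℝ := by
  obtain ⟨C, hC, -, hPC⟩ := hP.exists_sqrt_pinv
  -- The primitive of `g` takes values in the range of `P`, hence so does `g`; the range projection
  -- `P * (C * C)` fixes it.
  have hg : g = mulOp T (P * (C * C)) g := by
    apply volterra_injective hT
    rw [volterra_mulOp, ← h, ← mulOp_mul_apply, hPC]
  have hCV : expOp T ι w (volterra T ι (mulOp T C g)) =
      mulOp T C (mulOp T P (expOp T ι w d)) := by
    rw [volterra_mulOp, ← h, expOp_mulOp, expOp_mulOp]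
  have h1 := inner_volterra_ge hT w (mulOp T C g)
  rw [hCV, expOp_mulOp, ← real_inner_self_eq_norm_sq, inner_mulOp_sq hC, inner_mulOp_sq hC,
    inner_mulOp P, hP.transpose_eq, ← mulOp_mul_apply, ← mulOp_mul_apply, hPC] at h1
  rw [hg, expOp_mulOp]
  refine h1.trans (le_of_eq ?_)
  rw [inner_mulOp, ← mulOp_mul_apply]
  congr 3
  rw [Matrix.transpose_mul, Matrix.transpose_mul, hC, hP.transpose_eq]

/-- Index one linear differential-algebraic equations are solvable. -/
lemma exists_dae_solution (hT : 0 ≤ T) {P A : Matrix ι ι ℝ} (hP : P.PosSemidef)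
    (hA : ∀ v, P *ᵥ v = 0 → v ⬝ᵥ A *ᵥ v = 0 → v = 0) (c f : L2 T ι) :
    ∃ v, mulOp T P v = mulOp T P c + volterra T ι (mulOp T A v + f) := by
  obtain ⟨C, hC, hcomm, hPC⟩ := hP.exists_sqrt_pinv
  set G := C * C with hG
  have hGt : Gᵀ = G := by rw [hG, Matrix.transpose_mul, hC]
  -- The orthogonal projection onto the kernel of `P`. It isolates the algebraic constraint `Pi (A v
  -- + f) = 0`.
  set Pi := 1 - P * G with hPi
  have hPit : Piᵀ = Pi := by
    rw [hPi, Matrix.transpose_sub, Matrix.transpose_one, Matrix.transpose_mul, hGt,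
      hP.transpose_eq, hcomm]
  have hPiP : Pi * P = 0 := by rw [hPi, sub_mul, one_mul, hPC, sub_self]
  have hPPi : P * Pi = 0 := by
    rw [hPi, mul_sub, mul_one, hcomm, ← mul_assoc, hPC, sub_self]
  have hPiPi : Pi * Pi = Pi := by
    have : Pi * Pi = (1 - G * P) * Pi := by rw [← hcomm]
    rw [this, sub_mul, one_mul, mul_assoc, hPPi, mul_zero, sub_zero]
  -- If `P v = Pi A v`, both sides vanish because their ranges are complementary; then `v ∈ ker P`
  -- and `⟨v, Av⟩ = 0`, which `hA` excludes unless `v = 0`. This is the index-one property.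
  have hunit : IsUnit (P - Pi * A) := by
    apply Matrix.isUnit_of_forall_mulVec_eq_zero
    intro v hv
    rw [Matrix.sub_mulVec, sub_eq_zero] at hv
    have h1 : P *ᵥ v = 0 := by
      rw [hv, ← hPiPi, mul_assoc, ← Matrix.mulVec_mulVec, ← hv, Matrix.mulVec_mulVec, hPiP,
        Matrix.zero_mulVec]
    apply hA v h1
    have h2 : Pi *ᵥ v = v := by
      rw [hPi, Matrix.sub_mulVec, Matrix.one_mulVec, hcomm, ← Matrix.mulVec_mulVec, h1,
        Matrix.mulVec_zero, sub_zero]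
    calc v ⬝ᵥ A *ᵥ v = (Pi *ᵥ v) ⬝ᵥ A *ᵥ v := by rw [h2]
      _ = v ⬝ᵥ (Pi * A) *ᵥ v := by
        rw [← Matrix.mulVec_mulVec, Matrix.dotProduct_mulVec v, ← Matrix.mulVec_transpose, hPit]
      _ = 0 := by rw [← hv, h1, dotProduct_zero]
  have hdet := (Matrix.isUnit_iff_isUnit_det _).1 hunit
  set T0 := P - Pi * A with hT0
  -- Only the range component of the right-hand side is integrated, while the kernel component
  -- enters undifferentiated. After multiplication by `T0` this is `h2` below, whose projection
  -- under `Pi` is the constraint `h3`.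
  obtain ⟨v, hv⟩ := exists_volterra_solution hT (T0⁻¹ * (P * G * A))
    (mulOp T T0⁻¹ (mulOp T P c + volterra T ι (mulOp T (P * G) f) + mulOp T Pi f))
  refine ⟨v, ?_⟩
  have h1 := congrArg (mulOp T T0) hv
  rw [map_sub, ← volterra_mulOp, ← mulOp_mul_apply, ← mulOp_mul_apply, ← mul_assoc,
    Matrix.mul_nonsing_inv _ hdet, one_mul, mulOp_one_apply, hT0, mulOp_sub,
    sub_apply, mulOp_mul_apply, mulOp_mul_apply (P * G)] at h1
  set h := mulOp T A v + f with hh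
  have h2 : mulOp T P v = mulOp T P c + volterra T ι (mulOp T (P * G) h) + mulOp T Pi h := by
    rw [hh, map_add, map_add, map_add]
    rw [sub_sub, sub_eq_iff_eq_add] at h1
    rw [h1]
    abel
  have h3 : mulOp T Pi h = 0 := by
    have h4 := congrArg (mulOp T Pi) h2
    rw [map_add, map_add, ← volterra_mulOp, ← mulOp_mul_apply, ← mulOp_mul_apply,
      ← mulOp_mul_apply, ← mulOp_mul_apply, ← mul_assoc, hPiP, hPiPi, zero_mul, mulOp_zero] at h4
    simpa using h4.symm
  have h4 : mulOp T (P * G) h = h := by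
    have : P * G = 1 - Pi := by rw [hPi, sub_sub_cancel]
    rw [this, mulOp_sub, sub_apply, h3, mulOp_one_apply, sub_zero]
  rw [h2, h3, h4, add_zero]

end Operators

namespace CoupledDAE

variable {s m : ℕ} {n : Fin s → ℕ} {S : CoupledDAE s m n}

/-! ### Structure of the coefficient matrices. -/

section Matrices

/-- The matrix `E Q⁻¹`. -/
def P (S : CoupledDAE s m n) : Matrix (Idx n) (Idx n) ℝ := S.E * S.Q⁻¹

/-- The matrix `J_d - α R + μ E Q⁻¹`. -/
def A (S : CoupledDAE s m n) (α μ : ℝ) : Matrix (Idx n) (Idx n) ℝ :=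
  S.Jd - α • S.R + μ • (S.E * S.Q⁻¹)

lemma posSemidef_blockDiagonal' {A : ∀ i, Matrix (Fin (n i)) (Fin (n i)) ℝ}
    (h : ∀ i, (A i).PosSemidef) : (Matrix.blockDiagonal' A).PosSemidef := by
  choose C hC hCA using fun i => (h i).exists_symm_sq
  have : Matrix.blockDiagonal' A =
      (Matrix.blockDiagonal' C)ᴴ * Matrix.blockDiagonal' C := by
    rw [Matrix.conjTranspose_eq_transpose_of_trivial, Matrix.blockDiagonal'_transpose,
      ← Matrix.blockDiagonal'_mul]
    simp_rw [hC, hCA]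
  rw [this]
  exact Matrix.posSemidef_conjTranspose_mul_self _

lemma Admissible.isUnit_Q (hS : S.Admissible) : IsUnit S.Q := by
  refine IsUnit.of_mul_eq_one (Matrix.blockDiagonal' fun i => (S.Qb i)⁻¹) ?_
  rw [Q, ← Matrix.blockDiagonal'_mul, ← Matrix.blockDiagonal'_one]
  congr 1
  funext i
  exact Matrix.mul_nonsing_inv _ ((Matrix.isUnit_iff_isUnit_det _).1 (hS.Q_unit i))

lemma Admissible.isUnit_det_Q (hS : S.Admissible) : IsUnit S.Q.det :=
  (Matrix.isUnit_iff_isUnit_det _).1 hS.isUnit_Q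

lemma Admissible.P_mul_Q (hS : S.Admissible) : S.P * S.Q = S.E := by
  rw [P, mul_assoc, Matrix.nonsing_inv_mul _ hS.isUnit_det_Q, mul_one]

lemma Admissible.posSemidef_R (hS : S.Admissible) : S.R.PosSemidef :=
  posSemidef_blockDiagonal' hS.R_psd

/-- Congruence of `Eᵀ Q = Qᵀ E` by `Q⁻¹` gives `Q⁻ᵀ Qᵀ E Q⁻¹ = E Q⁻¹`. -/
lemma Admissible.posSemidef_P (hS : S.Admissible) : S.P.PosSemidef := by
  have h1 : S.Eᵀ * S.Q = Matrix.blockDiagonal' fun i => (S.Eb i)ᵀ * S.Qb i := by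
    rw [E, Q, Matrix.blockDiagonal'_transpose, ← Matrix.blockDiagonal'_mul]
  have h2 : S.Eᵀ * S.Q = S.Qᵀ * S.E := by
    rw [h1, E, Q, Matrix.blockDiagonal'_transpose, ← Matrix.blockDiagonal'_mul]
    congr 1
    exact funext hS.EQ_symm
  have h3 : (S.Eᵀ * S.Q).PosSemidef := by
    rw [h1]
    exact posSemidef_blockDiagonal' hS.EQ_psd
  have h4 := h3.conjTranspose_mul_mul_same S.Q⁻¹
  rwa [h2, Matrix.conjTranspose_eq_transpose_of_trivial, Matrix.transpose_nonsing_inv, ← mul_assoc,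
    Matrix.nonsing_inv_mul _ (by rw [Matrix.det_transpose]; exact hS.isUnit_det_Q), one_mul] at h4

lemma Admissible.Jd_skew (hS : S.Admissible) : S.Jdᵀ = -S.Jd := by
  rw [Jd, Matrix.blockDiagonal'_transpose, ← Matrix.blockDiagonal'_neg]
  congr 1
  exact funext hS.J_skew

lemma Jo_skew (S : CoupledDAE s m n) : S.Joᵀ = -S.Jo := by
  ext p q
  simp only [Jo, Matrix.transpose_apply, Matrix.of_apply, Matrix.neg_apply]
  rcases lt_trichotomy p.1 q.1 with h | h | h
  · simp [h, h.not_gt]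
  · simp [h]
  · simp [h, h.not_gt]

lemma K_add_Jo (S : CoupledDAE s m n) (α μ : ℝ) :
    S.K α μ + S.Jo = (1 - α) • S.R + μ • S.P := by
  rw [K, P, sub_add_cancel]

lemma Admissible.posSemidef_add (hS : S.Admissible) {a b : ℝ} (ha : 0 ≤ a) (hb : 0 ≤ b) :
    (a • S.R + b • S.P).PosSemidef :=
  (hS.posSemidef_R.smul ha).add (hS.posSemidef_P.smul hb)

lemma card_Idx (n : Fin s → ℕ) : Fintype.card (Idx n) = ∑ i, n i := by
  simp [Idx]

/-- The kernel of a sum of positive semidefinite matrices is the intersection of their kernels. By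
`E = PQ` and symmetry, a vector in it is annihilated by the transpose of `[bE, aR]`. Both rank
conditions are used through this lemma. -/
lemma Admissible.isUnit_of_rank (hS : S.Admissible) {a b : ℝ} (ha : 0 ≤ a) (hb : 0 ≤ b)
    (h : (Matrix.fromCols (b • S.E) (a • S.R)).rank = ∑ i, n i) :
    IsUnit (a • S.R + b • S.P) := by
  apply Matrix.isUnit_of_forall_mulVec_eq_zero
  intro v hv
  have hR := (hS.posSemidef_R.smul ha)
  have hP := (hS.posSemidef_P.smul hb)
  have h1 : v ⬝ᵥ (a • S.R) *ᵥ v + v ⬝ᵥ (b • S.P) *ᵥ v = 0 := by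
    rw [← dotProduct_add, ← Matrix.add_mulVec, hv, dotProduct_zero]
  have h2 := hR.dotProduct_nonneg v
  have h3 := hP.dotProduct_nonneg v
  have h4 := hR.mulVec_eq_zero (v := v) (by linarith)
  have h5 := hP.mulVec_eq_zero (v := v) (by linarith)
  rw [← card_Idx] at h
  apply Matrix.transpose_mulVec_injective_of_rank h
  rw [Matrix.transpose_fromCols, Matrix.fromRows_mulVec, hR.transpose_eq, h4, ← hS.P_mul_Q,
    ← Matrix.smul_mul, Matrix.transpose_mul, hP.transpose_eq, ← Matrix.mulVec_mulVec, h5,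
    Matrix.mulVec_zero]
  ext i
  rcases i with i | i <;> rfl

lemma Admissible.dotProduct_A (hS : S.Admissible) (α μ : ℝ) (v : Idx n → ℝ) :
    v ⬝ᵥ S.A α μ *ᵥ v = - α * (v ⬝ᵥ S.R *ᵥ v) + μ * (v ⬝ᵥ S.P *ᵥ v) := by
  rw [A, Matrix.add_mulVec, Matrix.sub_mulVec, dotProduct_add, dotProduct_sub,
    Matrix.dotProduct_skew hS.Jd_skew, Matrix.smul_mulVec, Matrix.smul_mulVec, dotProduct_smul,
    dotProduct_smul, P]
  simp

lemma dotProduct_K (S : CoupledDAE s m n) (α μ : ℝ) (v : Idx n → ℝ) :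
    v ⬝ᵥ S.K α μ *ᵥ v = v ⬝ᵥ ((1 - α) • S.R + μ • S.P) *ᵥ v := by
  rw [← K_add_Jo, Matrix.add_mulVec, dotProduct_add, Matrix.dotProduct_skew S.Jo_skew, add_zero]

lemma Admissible.isUnit_one_add_K (hS : S.Admissible) {l μ α : ℝ} (hl : 0 ≤ l) (hμ : 0 ≤ μ)
    (hα : α ≤ 1) : IsUnit (1 + l • S.K α μ) := by
  apply Matrix.isUnit_of_forall_mulVec_eq_zero
  intro v hv
  have h1 : v ⬝ᵥ v + l * (v ⬝ᵥ S.K α μ *ᵥ v) = 0 := by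
    rw [← smul_eq_mul, ← dotProduct_smul, ← Matrix.smul_mulVec, ← dotProduct_add]
    nth_rewrite 2 [← Matrix.one_mulVec v]
    rw [← Matrix.add_mulVec, hv, dotProduct_zero]
  have h2 := (hS.posSemidef_add (sub_nonneg.2 hα) hμ).dotProduct_nonneg v
  rw [← dotProduct_K] at h2
  have h3 : 0 ≤ v ⬝ᵥ v := Finset.sum_nonneg fun i _ => mul_self_nonneg _
  have h4 := mul_nonneg hl h2
  exact dotProduct_self_eq_zero.1 (by linarith)

end Matrices

/-! ### The operators `M Q⁻¹` and `N Q⁻¹`, the resolvent and the error recursion. -/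

section Operators

lemma Admissible.Qinv_Q (hS : S.Admissible) (x : L2 S.T (Idx n)) :
    mulOp S.T S.Q⁻¹ (mulOp S.T S.Q x) = x := by
  rw [← mulOp_mul_apply, Matrix.nonsing_inv_mul _ hS.isUnit_det_Q, mulOp_one_apply]

lemma Admissible.Q_Qinv (hS : S.Admissible) (x : L2 S.T (Idx n)) :
    mulOp S.T S.Q (mulOp S.T S.Q⁻¹ x) = x := by
  rw [← mulOp_mul_apply, Matrix.mul_nonsing_inv _ hS.isUnit_det_Q, mulOp_one_apply]

lemma Admissible.P_Q (hS : S.Admissible) (x : L2 S.T (Idx n)) :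
    mulOp S.T S.P (mulOp S.T S.Q x) = mulOp S.T S.E x := by
  rw [← mulOp_mul_apply, hS.P_mul_Q]

lemma Admissible.NQ_eq (hS : S.Admissible) (α μ : ℝ) : S.NQ α μ = mulOp S.T (S.K α μ) := by
  ext1 f
  rw [NQ, ContinuousLinearMap.comp_apply, N, mulOp_mul_apply, hS.Q_Qinv, K]

lemma Admissible.MQ_Q (hS : S.Admissible) (α μ : ℝ) (x : L2 S.T (Idx n)) :
    S.MQ α μ (mulOp S.T S.Q x) = weakDeriv (mulOp S.T S.E x)
      - mulOp S.T (S.A α μ) (mulOp S.T S.Q x) - mulOp S.T S.B S.u := by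
  rw [MQ, hS.Qinv_Q, M, mulOp_mul_apply, A]

lemma Admissible.exists_of_mem_dom (hS : S.Admissible) {x : L2 S.T (Idx n)} (hx : x ∈ S.dom) :
    ∃ g, IsWeakDeriv (mulOp S.T S.E x) g ∧
      mulOp S.T S.E x = constOp S.T (Idx n) (matVec S.E S.x₀) + volterra S.T (Idx n) g := by
  obtain ⟨⟨g, hg⟩, h0⟩ := hx
  exact ⟨g, hg, hg.eq_constOp_add_volterra hS.T_pos h0⟩

/-- Differences of elements of the domain. -/
lemma Admissible.exists_sub_of_mem_dom (hS : S.Admissible) (α μ : ℝ) {x y : L2 S.T (Idx n)}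
    (hx : x ∈ S.dom) (hy : y ∈ S.dom) :
    ∃ g, IsWeakDeriv (mulOp S.T S.E x - mulOp S.T S.E y) g ∧
      mulOp S.T S.P (mulOp S.T S.Q x - mulOp S.T S.Q y) = volterra S.T (Idx n) g ∧
      S.MQ α μ (mulOp S.T S.Q x) - S.MQ α μ (mulOp S.T S.Q y) =
        g - mulOp S.T (S.A α μ) (mulOp S.T S.Q x - mulOp S.T S.Q y) := by
  obtain ⟨g, hg, hgx⟩ := hS.exists_of_mem_dom hx
  obtain ⟨g', hg', hgy⟩ := hS.exists_of_mem_dom hy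
  refine ⟨g - g', hg.sub hg', ?_, ?_⟩
  · rw [map_sub, hS.P_Q, hS.P_Q, hgx, hgy, map_sub]
    abel
  · rw [hS.MQ_Q, hS.MQ_Q, hg.weakDeriv_eq, hg'.weakDeriv_eq, map_sub]
    abel

/-- Monotonicity of `M Q⁻¹` in weighted spaces. -/
lemma Admissible.inner_MQ_ge (hS : S.Admissible) (α μ w : ℝ) {x y : L2 S.T (Idx n)}
    (hx : x ∈ S.dom) (hy : y ∈ S.dom) :
    ⟪expOp S.T (Idx n) w (mulOp S.T S.Q x - mulOp S.T S.Q y),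
        mulOp S.T (α • S.R + (w - μ) • S.P)
          (expOp S.T (Idx n) w (mulOp S.T S.Q x - mulOp S.T S.Q y))⟫_ℝ ≤
      ⟪expOp S.T (Idx n) w (mulOp S.T S.Q x - mulOp S.T S.Q y),
        expOp S.T (Idx n) w
          (S.MQ α μ (mulOp S.T S.Q x) - S.MQ α μ (mulOp S.T S.Q y))⟫_ℝ := by
  obtain ⟨g, -, hg, hM⟩ := hS.exists_sub_of_mem_dom α μ hx hy
  rw [hM]
  have h1 := inner_expOp_volterra_ge hS.T_pos.le w hS.posSemidef_P hg
  generalize mulOp S.T S.Q x - mulOp S.T S.Q y = d at h1 ⊢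
  rw [map_sub, expOp_mulOp]
  generalize expOp S.T (Idx n) w d = f at h1 ⊢
  rw [A, ← P]
  simp only [mulOp_add, mulOp_sub, mulOp_smul]
  simp only [add_apply, sub_apply, smul_apply, inner_add_right, inner_sub_right, inner_smul_right,
    inner_mulOp_skew hS.Jd_skew]
  rw [real_inner_comm f (expOp S.T (Idx n) w g)] at h1
  linarith

lemma inner_K (S : CoupledDAE s m n) (α μ : ℝ) (f : L2 S.T (Idx n)) :
    ⟪f, mulOp S.T (S.K α μ) f⟫_ℝ = ⟪f, mulOp S.T ((1 - α) • S.R + μ • S.P) f⟫_ℝ := by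
  rw [← K_add_Jo, mulOp_add, add_apply, inner_add_right, inner_mulOp_skew S.Jo_skew, add_zero]

lemma Admissible.inner_K_nonneg (hS : S.Admissible) {μ α : ℝ} (hμ : 0 ≤ μ) (hα : α ≤ 1)
    (f : L2 S.T (Idx n)) : 0 ≤ ⟪f, mulOp S.T (S.K α μ) f⟫_ℝ := by
  rw [inner_K]
  exact inner_mulOp_nonneg (hS.posSemidef_add (sub_nonneg.2 hα) hμ) f

lemma Admissible.isUnit_one_add_NQ (hS : S.Admissible) {l μ α : ℝ} (hl : 0 ≤ l) (hμ : 0 ≤ μ)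
    (hα : α ≤ 1) : IsUnit (1 + l • S.NQ α μ) := by
  have h := hS.isUnit_one_add_K hl hμ hα
  have hdet := (Matrix.isUnit_iff_isUnit_det _).1 h
  have e : 1 + l • S.NQ α μ = mulOp S.T (1 + l • S.K α μ) := by
    rw [hS.NQ_eq, mulOp_add, mulOp_smul, mulOp_one]
  rw [e]
  refine ⟨⟨_, mulOp S.T (1 + l • S.K α μ)⁻¹, ?_, ?_⟩, rfl⟩
  · ext1 f
    change mulOp S.T _ (mulOp S.T _ f) = f
    rw [← mulOp_mul_apply, Matrix.mul_nonsing_inv _ hdet, mulOp_one_apply]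
  · ext1 f
    change mulOp S.T _ (mulOp S.T _ f) = f
    rw [← mulOp_mul_apply, Matrix.nonsing_inv_mul _ hdet, mulOp_one_apply]

/-- The operator `I + l M Q⁻¹` is surjective. -/
lemma Admissible.exists_resolvent (hS : S.Admissible) {l μ α : ℝ} (hl : 0 < l) (hα : 0 ≤ α)
    (f : L2 S.T (Idx n)) :
    ∃ v ∈ mulOp S.T S.Q '' S.dom, v + l • S.MQ α μ v = f := by
  -- Dividing by `l`, the resolvent equation reads `(Pv)' = (A - l⁻¹)v + Bu + l⁻¹f`. On `ker P` the
  -- form of `A - l⁻¹` is `-α⟨v, Rv⟩ - l⁻¹‖v‖²`, which is negative definite.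
  have hA : ∀ v, S.P *ᵥ v = 0 → v ⬝ᵥ (S.A α μ - l⁻¹ • (1 : Matrix (Idx n) (Idx n) ℝ)) *ᵥ v = 0 →
      v = 0 := by
    intro v h1 h2
    rw [Matrix.sub_mulVec, dotProduct_sub, hS.dotProduct_A, h1, dotProduct_zero,
      Matrix.smul_mulVec, dotProduct_smul, Matrix.one_mulVec, smul_eq_mul] at h2
    have h3 := mul_nonneg hα (hS.posSemidef_R.dotProduct_nonneg v)
    have h4 : 0 ≤ v ⬝ᵥ v := Finset.sum_nonneg fun i _ => mul_self_nonneg _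
    have h5 := mul_nonneg (inv_pos.2 hl).le h4
    have h6 : l⁻¹ * (v ⬝ᵥ v) = 0 := by linarith
    exact dotProduct_self_eq_zero.1 ((mul_eq_zero.1 h6).resolve_left (inv_pos.2 hl).ne')
  obtain ⟨v, hv⟩ := exists_dae_solution hS.T_pos.le hS.posSemidef_P hA
    (constOp S.T (Idx n) (matVec S.Q S.x₀)) (mulOp S.T S.B S.u + l⁻¹ • f)
  set g := mulOp S.T (S.A α μ - l⁻¹ • (1 : Matrix (Idx n) (Idx n) ℝ)) v +
    (mulOp S.T S.B S.u + l⁻¹ • f) with hg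
  have hE : mulOp S.T S.E (mulOp S.T S.Q⁻¹ v) =
      constOp S.T (Idx n) (matVec S.E S.x₀) + volterra S.T (Idx n) g := by
    rw [← hS.P_Q, hS.Q_Qinv, hv, mulOp_constOp, ← hS.P_mul_Q, matVec_mul]
    rfl
  have hw := isWeakDeriv_constOp_add_volterra hS.T_pos.le (matVec S.E S.x₀) g
  refine ⟨v, ⟨mulOp S.T S.Q⁻¹ v, ⟨⟨g, ?_⟩, ?_⟩, hS.Q_Qinv v⟩, ?_⟩
  · rw [hE]; exact hw
  · rw [hE]; exact hasInitialValue_constOp_add_volterra _ _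
  · have h1 := hS.MQ_Q α μ (mulOp S.T S.Q⁻¹ v)
    rw [hS.Q_Qinv, hE, hw.weakDeriv_eq, hg, mulOp_sub, sub_apply, mulOp_smul, smul_apply,
      mulOp_one_apply] at h1
    have h2 : S.MQ α μ v = l⁻¹ • (f - v) := by
      rw [h1, smul_sub]; abel
    rw [h2, smul_smul, mul_inv_cancel₀ hl.ne', one_smul, add_sub_cancel]

/-- Surjectivity suffices here: the preimage selected by `Function.invFunOn` satisfies the equation
whichever one it is. -/
lemma Admissible.resolventMQ_spec (hS : S.Admissible) {l μ α : ℝ} (hl : 0 < l) (hα : 0 ≤ α)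
    (f : L2 S.T (Idx n)) :
    S.resolventMQ α μ l f ∈ mulOp S.T S.Q '' S.dom ∧
      S.resolventMQ α μ l f + l • S.MQ α μ (S.resolventMQ α μ l f) = f := by
  obtain ⟨v, hv, hvf⟩ := hS.exists_resolvent (μ := μ) hl hα f
  have hex : ∃ v ∈ mulOp S.T S.Q '' S.dom, (fun v => v + l • S.MQ α μ v) v = f := ⟨v, hv, hvf⟩
  exact ⟨Function.invFunOn_mem hex, Function.invFunOn_eq hex⟩

lemma Admissible.step_mem_dom (hS : S.Admissible) {l μ α : ℝ} (hl : 0 < l) (hα : 0 ≤ α)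
    (x : L2 S.T (Idx n)) : S.step α μ l x ∈ S.dom := by
  obtain ⟨y, hy, hyr⟩ := (hS.resolventMQ_spec (μ := μ) hl hα
    ((1 - l • S.NQ α μ) (Ring.inverse (1 + l • S.NQ α μ)
      (mulOp S.T S.Q x - l • S.MQ α μ (mulOp S.T S.Q x))))).1
  rw [step, ← hyr, hS.Qinv_Q]
  exact hy

lemma Admissible.zOf_step (hS : S.Admissible) {l μ α : ℝ} (hl : 0 < l) (hα : 0 ≤ α)
    (x : L2 S.T (Idx n)) : S.zOf α μ l (S.step α μ l x) =
      (1 - l • S.NQ α μ) (Ring.inverse (1 + l • S.NQ α μ)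
        (mulOp S.T S.Q x - l • S.MQ α μ (mulOp S.T S.Q x))) := by
  rw [zOf, step, hS.Q_Qinv]
  exact (hS.resolventMQ_spec hl hα _).2

lemma Admissible.MQ_of_isSolution (hS : S.Admissible) (α μ : ℝ) {x : L2 S.T (Idx n)}
    (hx : S.IsSolution x) : S.MQ α μ (mulOp S.T S.Q x) = - S.NQ α μ (mulOp S.T S.Q x) := by
  rw [hS.MQ_Q, hx.2, hS.NQ_eq, mulOp_mul_apply, eq_neg_iff_add_eq_zero]
  have e : S.J - S.R = S.A α μ - S.K α μ := by
    rw [A, K, J, sub_smul, one_smul]; abel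
  rw [e, mulOp_sub, sub_apply]
  abel

/-- The error recursion of the iteration. -/
lemma Admissible.exists_error_step (hS : S.Admissible) {l μ α : ℝ} (hl : 0 < l) (hμ : 0 ≤ μ)
    (hα : α ∈ Set.Icc (0 : ℝ) 1) (w : ℝ) {x' : L2 S.T (Idx n)} (hx' : S.IsSolution x')
    (x : L2 S.T (Idx n)) :
    ∃ y : L2 S.T (Idx n),
      expOp S.T (Idx n) w (mulOp S.T S.Q x - mulOp S.T S.Q x') -
        l • expOp S.T (Idx n) w (S.MQ α μ (mulOp S.T S.Q x) - S.MQ α μ (mulOp S.T S.Q x')) =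
        y + l • mulOp S.T (S.K α μ) y ∧
      expOp S.T (Idx n) w (S.zOf α μ l (S.step α μ l x) - S.zOf α μ l x') =
        y - l • mulOp S.T (S.K α μ) y := by
  have hu := hS.isUnit_one_add_NQ hl.le hμ hα.2
  set f := mulOp S.T S.Q x - l • S.MQ α μ (mulOp S.T S.Q x) with hf
  set v := mulOp S.T S.Q x' with hv
  set y := Ring.inverse (1 + l • S.NQ α μ) f with hy
  have h1 : y + l • S.NQ α μ y = f :=
    congrArg (fun A : L2 S.T (Idx n) →L[ℝ] L2 S.T (Idx n) => A f) (Ring.mul_inverse_cancel _ hu)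
  have h2 : S.MQ α μ v = - S.NQ α μ v := hS.MQ_of_isSolution α μ hx'
  have h3 : S.zOf α μ l (S.step α μ l x) = y - l • S.NQ α μ y := hS.zOf_step hl hα.1 x
  -- For the exact solution `M Q⁻¹ v = -N Q⁻¹ v`, so `v` itself plays the role of `y`; subtraction
  -- removes the affine part of `M`.
  refine ⟨expOp S.T (Idx n) w (y - v), ?_, ?_⟩
  · rw [← expOp_mulOp, ← map_smul, ← map_smul, ← map_sub, ← map_add, ← hS.NQ_eq, map_sub (S.NQ α μ),
      h2]
    congr 1
    rw [smul_sub, smul_sub, smul_neg, sub_neg_eq_add]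
    rw [hf, ← sub_eq_zero] at h1
    rw [← sub_eq_zero, ← neg_eq_zero, ← h1]
    abel
  · rw [← expOp_mulOp, ← map_smul, ← map_sub, ← hS.NQ_eq, map_sub (S.NQ α μ), h3, zOf, ← hv, h2]
    congr 1
    rw [smul_sub, smul_neg]
    abel

end Operators

end CoupledDAE

namespace CoupledDAE

variable {s m : ℕ} {n : Fin s → ℕ} {S : CoupledDAE s m n}

/-! ### The contraction number and the Cayley transform of `K`. -/

section Contraction

lemma exists_ne_zero_L2 {T : ℝ} (hT : 0 < T) {ι : Type} [Fintype ι] [DecidableEq ι] [Nonempty ι] :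
    ∃ f : L2 T ι, f ≠ 0 := by
  obtain ⟨i⟩ := ‹Nonempty ι›
  refine ⟨constOp T ι (EuclideanSpace.single i 1), fun h => ?_⟩
  have h1 : ∀ᵐ t ∂(volume.restrict (Set.Icc (0 : ℝ) T)), False := by
    filter_upwards [constOp_ae (T := T) (EuclideanSpace.single i (1 : ℝ)),
      Lp.coeFn_zero (EuclideanSpace ℝ ι) 2 (volume.restrict (Set.Icc (0 : ℝ) T))] with t e1 e2
    rw [h, e2] at e1
    simpa using congrArg (fun v : EuclideanSpace ℝ ι => v i) e1
  rw [ae_iff] at h1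
  simp at h1
  linarith

/-- The square of the contraction number. -/
def rate (S : CoupledDAE s m n) (α μ l : ℝ) : ℝ :=
  1 - 4 * l / ((1 + l * specNorm (S.K α μ)) ^ 2 * specNorm ((S.K α μ + S.Jo)⁻¹))

variable {l μ α : ℝ}

lemma Admissible.norm_sq_le_inner_K (hS : S.Admissible) (hμ : 0 ≤ μ) (hα : α ≤ 1)
    (hr : S.RankCond α μ) (f : L2 S.T (Idx n)) :
    ‖f‖ ^ 2 ≤ specNorm ((S.K α μ + S.Jo)⁻¹) * ⟪f, mulOp S.T (S.K α μ) f⟫_ℝ := by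
  rw [inner_K, K_add_Jo]
  exact norm_sq_le_specNorm_inv_mul (hS.posSemidef_add (sub_nonneg.2 hα) hμ)
    (hS.isUnit_of_rank (sub_nonneg.2 hα) hμ hr) f

/-- Testing coercivity on one nonzero `f` gives `‖f‖² ≤ ‖(K + J_o)⁻¹‖ ‖K‖ ‖f‖²`. Such an `f` exists
because the state space is nontrivial and `T > 0`. -/
lemma Admissible.specNorm_inv_pos (hS : S.Admissible) (hn : 0 < ∑ i, n i) (hμ : 0 ≤ μ)
    (hα : α ≤ 1) (hr : S.RankCond α μ) :
    0 < specNorm ((S.K α μ + S.Jo)⁻¹) ∧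
      1 ≤ specNorm ((S.K α μ + S.Jo)⁻¹) * specNorm (S.K α μ) := by
  have : Nonempty (Idx n) := by
    rw [← Fintype.card_pos_iff, card_Idx]
    exact hn
  obtain ⟨f, hf⟩ := exists_ne_zero_L2 (ι := Idx n) hS.T_pos
  have hf0 : 0 < ‖f‖ ^ 2 := pow_pos (norm_pos_iff.2 hf) 2
  have h1 := hS.norm_sq_le_inner_K hμ hα hr f
  have h2 : ⟪f, mulOp S.T (S.K α μ) f⟫_ℝ ≤ specNorm (S.K α μ) * ‖f‖ ^ 2 := by
    refine (real_inner_le_norm _ _).trans ?_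
    nlinarith [norm_mulOp_le (S.K α μ) f, norm_nonneg f]
  have h3 : 0 ≤ specNorm ((S.K α μ + S.Jo)⁻¹) := norm_nonneg _
  have h4 := h1.trans (mul_le_mul_of_nonneg_left h2 h3)
  rw [← mul_assoc] at h4
  have h5 : 1 ≤ specNorm ((S.K α μ + S.Jo)⁻¹) * specNorm (S.K α μ) := by
    by_contra hcon
    push Not at hcon
    nlinarith
  refine ⟨h3.lt_of_ne' fun h0 => ?_, h5⟩
  rw [h0, zero_mul] at h5
  linarith

/-- Nonnegativity combines `4λ‖K‖ ≤ (1 + λ‖K‖)²` with `1 ≤ ‖(K + J_o)⁻¹‖ ‖K‖`. -/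
lemma Admissible.rate_mem (hS : S.Admissible) (hn : 0 < ∑ i, n i) (hl : 0 < l) (hμ : 0 ≤ μ)
    (hα : α ≤ 1) (hr : S.RankCond α μ) : 0 ≤ S.rate α μ l ∧ S.rate α μ l < 1 := by
  obtain ⟨h1, h2⟩ := hS.specNorm_inv_pos hn hμ hα hr
  have h3 : 0 ≤ specNorm (S.K α μ) := norm_nonneg _
  have h4 : 0 < (1 + l * specNorm (S.K α μ)) ^ 2 * specNorm ((S.K α μ + S.Jo)⁻¹) := by positivity
  constructor
  · rw [rate, sub_nonneg, div_le_one h4]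
    nlinarith [mul_nonneg (sq_nonneg (1 - l * specNorm (S.K α μ))) h1.le]
  · rw [rate, sub_lt_self_iff]
    positivity

lemma norm_sq_add_smul_eq {T : ℝ} {ι : Type} [Fintype ι] (a b : L2 T ι) (c : ℝ) :
    ‖a + c • b‖ ^ 2 = ‖a - c • b‖ ^ 2 + 4 * c * ⟪a, b⟫_ℝ := by
  rw [norm_add_sq_real, norm_sub_sq_real, inner_smul_right]
  ring

/-- The Cayley transform of `K` is a contraction. -/
lemma Admissible.cayley_contraction (hS : S.Admissible) (hn : 0 < ∑ i, n i) (hl : 0 < l)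
    (hμ : 0 ≤ μ) (hα : α ≤ 1) (hr : S.RankCond α μ) (y : L2 S.T (Idx n)) :
    ‖y - l • mulOp S.T (S.K α μ) y‖ ^ 2 ≤
      S.rate α μ l * ‖y + l • mulOp S.T (S.K α μ) y‖ ^ 2 := by
  obtain ⟨h1, -⟩ := hS.specNorm_inv_pos hn hμ hα hr
  have h2 := norm_sq_add_smul_eq y (mulOp S.T (S.K α μ) y) l
  have h3 := hS.norm_sq_le_inner_K hμ hα hr y
  have h0 : 0 ≤ specNorm (S.K α μ) := norm_nonneg _
  have h4 : ‖y + l • mulOp S.T (S.K α μ) y‖ ≤ (1 + l * specNorm (S.K α μ)) * ‖y‖ := by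
    refine (norm_add_le _ _).trans ?_
    rw [norm_smul, Real.norm_of_nonneg hl.le]
    nlinarith [mul_le_mul_of_nonneg_left (norm_mulOp_le (S.K α μ) y) hl.le]
  have h5 := pow_le_pow_left₀ (norm_nonneg _) h4 2
  rw [mul_pow] at h5
  have h6 : 0 < (1 + l * specNorm (S.K α μ)) ^ 2 := by positivity
  have h7 := h5.trans (mul_le_mul_of_nonneg_left h3 h6.le)
  have h8 : 4 * l / ((1 + l * specNorm (S.K α μ)) ^ 2 * specNorm ((S.K α μ + S.Jo)⁻¹)) *
      ‖y + l • mulOp S.T (S.K α μ) y‖ ^ 2 ≤ 4 * l * ⟪y, mulOp S.T (S.K α μ) y⟫_ℝ := by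
    rw [div_mul_eq_mul_div, div_le_iff₀ (by positivity)]
    nlinarith
  rw [rate, sub_mul, one_mul]
  linarith

end Contraction

/-! ### Decay of the error and convergence of the iterates. -/

section Iteration

variable {l μ α : ℝ}

lemma Admissible.inner_MQ_nonneg (hS : S.Admissible) (hα : 0 ≤ α) {w : ℝ} (hw : μ ≤ w)
    {x y : L2 S.T (Idx n)} (hx : x ∈ S.dom) (hy : y ∈ S.dom) :
    0 ≤ ⟪expOp S.T (Idx n) w (mulOp S.T S.Q x - mulOp S.T S.Q y), expOp S.T (Idx n) w
          (S.MQ α μ (mulOp S.T S.Q x) - S.MQ α μ (mulOp S.T S.Q y))⟫_ℝ :=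
  (inner_mulOp_nonneg (hS.posSemidef_add hα (sub_nonneg.2 hw)) _).trans
    (hS.inner_MQ_ge α μ w hx hy)

lemma expOp_zOf_sub (α μ l w : ℝ) (x y : L2 S.T (Idx n)) :
    expOp S.T (Idx n) w (S.zOf α μ l x - S.zOf α μ l y) =
      expOp S.T (Idx n) w (mulOp S.T S.Q x - mulOp S.T S.Q y) + l • expOp S.T (Idx n) w
        (S.MQ α μ (mulOp S.T S.Q x) - S.MQ α μ (mulOp S.T S.Q y)) := by
  rw [← map_smul, ← map_add, zOf, zOf, smul_sub]
  congr 1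
  abel

/-- Here the gain from `K` is discarded and the defect of `M` kept, so no rank condition is needed;
the defect is controlled by the decrement of the squared error. -/
lemma Admissible.norm_zOf_step_sq_add_le (hS : S.Admissible) (hl : 0 < l) (hμ : 0 ≤ μ)
    (hα : α ∈ Set.Icc (0 : ℝ) 1) (w : ℝ) {x x' : L2 S.T (Idx n)} (hx' : S.IsSolution x') :
    ‖expOp S.T (Idx n) w (S.zOf α μ l (S.step α μ l x) - S.zOf α μ l x')‖ ^ 2 +
      4 * l * ⟪expOp S.T (Idx n) w (mulOp S.T S.Q x - mulOp S.T S.Q x'), expOp S.T (Idx n) w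
          (S.MQ α μ (mulOp S.T S.Q x) - S.MQ α μ (mulOp S.T S.Q x'))⟫_ℝ ≤
      ‖expOp S.T (Idx n) w (S.zOf α μ l x - S.zOf α μ l x')‖ ^ 2 := by
  obtain ⟨y, h1, h2⟩ := hS.exists_error_step hl hμ hα w hx' x
  have h3 := norm_sq_add_smul_eq y (mulOp S.T (S.K α μ) y) l
  have h4 := mul_nonneg hl.le (hS.inner_K_nonneg hμ hα.2 y)
  rw [h2, expOp_zOf_sub α μ l w x, norm_sq_add_smul_eq (expOp S.T (Idx n) w _), h1]
  linarith

lemma Admissible.norm_zOf_step_sq_le (hS : S.Admissible) (hn : 0 < ∑ i, n i) (hl : 0 < l)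
    (hμ : 0 ≤ μ) (hα : α ∈ Set.Icc (0 : ℝ) 1) (hr : S.RankCond α μ) {w : ℝ} (hw : μ ≤ w)
    {x x' : L2 S.T (Idx n)} (hx : x ∈ S.dom) (hx' : S.IsSolution x') :
    ‖expOp S.T (Idx n) w (S.zOf α μ l (S.step α μ l x) - S.zOf α μ l x')‖ ^ 2 ≤
      S.rate α μ l * ‖expOp S.T (Idx n) w (S.zOf α μ l x - S.zOf α μ l x')‖ ^ 2 := by
  obtain ⟨y, h1, h2⟩ := hS.exists_error_step hl hμ hα w hx' x
  rw [h2]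
  refine (hS.cayley_contraction hn hl hμ hα.2 hr y).trans
    (mul_le_mul_of_nonneg_left ?_ (hS.rate_mem hn hl hμ hα.2 hr).1)
  rw [expOp_zOf_sub, norm_sq_add_smul_eq (expOp S.T (Idx n) w _), h1]
  have := mul_nonneg hl.le (hS.inner_MQ_nonneg hα.1 hw hx hx'.1)
  linarith

/-- In the expansion of `‖d + λg‖²` the cross term is nonnegative by monotonicity: the resolvent of
`M Q⁻¹` is nonexpansive in the weighted norm. -/
lemma Admissible.norm_expOp_Q_sub_le (hS : S.Admissible) (hl : 0 < l) (hα : 0 ≤ α) {w : ℝ}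
    (hw : μ ≤ w) {x y : L2 S.T (Idx n)} (hx : x ∈ S.dom) (hy : y ∈ S.dom) :
    ‖expOp S.T (Idx n) w (mulOp S.T S.Q x - mulOp S.T S.Q y)‖ ≤
      ‖expOp S.T (Idx n) w (S.zOf α μ l x - S.zOf α μ l y)‖ := by
  rw [expOp_zOf_sub]
  refine le_of_sq_le_sq ?_ (norm_nonneg _)
  rw [norm_add_sq_real, inner_smul_right]
  have := mul_nonneg hl.le (hS.inner_MQ_nonneg hα hw hx hy)
  nlinarith [sq_nonneg ‖l • expOp S.T (Idx n) w
        (S.MQ α μ (mulOp S.T S.Q x) - S.MQ α μ (mulOp S.T S.Q y))‖]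

lemma Admissible.tendsto_of_tendsto_Q (hS : S.Admissible) {xs : ℕ → L2 S.T (Idx n)}
    {x : L2 S.T (Idx n)}
    (h : Tendsto (fun k => mulOp S.T S.Q (xs k)) atTop (𝓝 (mulOp S.T S.Q x))) :
    Tendsto xs atTop (𝓝 x) := by
  have h1 := ((mulOp S.T S.Q⁻¹).continuous.tendsto _).comp h
  rw [hS.Qinv_Q] at h1
  exact h1.congr fun k => hS.Qinv_Q _

/-- Convergence of the transformed iterates implies convergence of the iterates. -/
lemma Admissible.tendsto_of_tendsto_zOf (hS : S.Admissible) (hl : 0 < l) (hμ : 0 ≤ μ)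
    (hα : 0 ≤ α) {xs : ℕ → L2 S.T (Idx n)} {x : L2 S.T (Idx n)} (hxs : ∀ k, xs k ∈ S.dom)
    (hx : x ∈ S.dom)
    (h : Tendsto (fun k => S.zOf α μ l (xs k)) atTop (𝓝 (S.zOf α μ l x))) :
    Tendsto xs atTop (𝓝 x) := by
  apply hS.tendsto_of_tendsto_Q
  apply tendsto_of_expOp hμ
  refine squeeze_zero (fun _ => norm_nonneg _)
    (fun k => (hS.norm_expOp_Q_sub_le hl hα le_rfl (hxs k) hx).trans (norm_expOp_le hμ _)) ?_
  exact tendsto_iff_norm_sub_tendsto_zero.1 h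

lemma Admissible.tendsto_h1Norm (hS : S.Admissible) (hl : 0 < l)
    {xs : ℕ → L2 S.T (Idx n)} {x : L2 S.T (Idx n)} (hxs : ∀ k, xs k ∈ S.dom)
    (hx : x ∈ S.dom) (hlim : Tendsto xs atTop (𝓝 x))
    (h : Tendsto (fun k => S.zOf α μ l (xs k)) atTop (𝓝 (S.zOf α μ l x))) :
    Tendsto (fun k => h1Norm (mulOp S.T S.E (xs k) - mulOp S.T S.E x)) atTop (𝓝 0) := by
  have hQ := ((mulOp S.T S.Q).continuous.tendsto _).comp hlim
  have hM : ∀ y, S.MQ α μ (mulOp S.T S.Q y) = l⁻¹ • (S.zOf α μ l y - mulOp S.T S.Q y) := by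
    intro y
    rw [zOf, add_sub_cancel_left, smul_smul, inv_mul_cancel₀ hl.ne', one_smul]
  -- The definition of `z` is solved for the derivative, which is thus a continuous function of the
  -- errors in `z` and `Qx`.
  have hd : ∀ k, weakDeriv (mulOp S.T S.E (xs k) - mulOp S.T S.E x) =
      l⁻¹ • ((S.zOf α μ l (xs k) - S.zOf α μ l x) - (mulOp S.T S.Q (xs k) - mulOp S.T S.Q x)) +
        mulOp S.T (S.A α μ) (mulOp S.T S.Q (xs k) - mulOp S.T S.Q x) := by
    intro k
    obtain ⟨g, hg, -, hgM⟩ := hS.exists_sub_of_mem_dom α μ (hxs k) hx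
    rw [hg.weakDeriv_eq, ← sub_eq_iff_eq_add, ← hgM, hM, hM, ← smul_sub]
    congr 1
    abel
  have h1 : Tendsto (fun k => mulOp S.T S.E (xs k) - mulOp S.T S.E x) atTop (𝓝 0) := by
    rw [← sub_self (mulOp S.T S.E x)]
    exact (((mulOp S.T S.E).continuous.tendsto _).comp hlim).sub_const _
  have hz0 : Tendsto (fun k => S.zOf α μ l (xs k) - S.zOf α μ l x) atTop (𝓝 0) := by
    rw [← sub_self (S.zOf α μ l x)]
    exact h.sub_const _
  have hQ0 : Tendsto (fun k => mulOp S.T S.Q (xs k) - mulOp S.T S.Q x) atTop (𝓝 0) := by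
    rw [← sub_self (mulOp S.T S.Q x)]
    exact hQ.sub_const _
  have h2 : Tendsto (fun k => weakDeriv (mulOp S.T S.E (xs k) - mulOp S.T S.E x)) atTop
      (𝓝 0) := by
    simp_rw [hd]
    have := ((hz0.sub hQ0).const_smul l⁻¹).add
      (((mulOp S.T (S.A α μ)).continuous.tendsto _).comp hQ0)
    simpa using this
  have h3 := ((h1.norm.pow 2).add (h2.norm.pow 2)).sqrt
  simpa [h1Norm] using h3

/-- Convergence of the iterates from the dissipation of `M`. -/
lemma Admissible.tendsto_of_rankCond' (hS : S.Admissible) (hl : 0 < l) (hμ : 0 ≤ μ)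
    (hα : α ∈ Set.Icc (0 : ℝ) 1) (hr : S.RankCond' α) {xs : ℕ → L2 S.T (Idx n)}
    {x : L2 S.T (Idx n)} (hxs : ∀ k, xs k ∈ S.dom) (hx : S.IsSolution x)
    (hstep : ∀ k, xs (k + 1) = S.step α μ l (xs k)) : Tendsto xs atTop (𝓝 x) := by
  -- This choice gives `w - μ = 1`, so the defect of `M` dominates the form of `αR + P`, which is
  -- positive definite under `RankCond'`.
  set w := μ + 1 with hw
  set a : ℕ → ℝ := fun k => ‖expOp S.T (Idx n) w (S.zOf α μ l (xs k) - S.zOf α μ l x)‖ ^ 2 with ha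
  set d : ℕ → L2 S.T (Idx n) := fun k =>
    expOp S.T (Idx n) w (mulOp S.T S.Q (xs k) - mulOp S.T S.Q x) with hd
  set b : ℕ → ℝ := fun k => ⟪d k, expOp S.T (Idx n) w
    (S.MQ α μ (mulOp S.T S.Q (xs k)) - S.MQ α μ (mulOp S.T S.Q x))⟫_ℝ with hb
  have hab : ∀ k, a (k + 1) + 4 * l * b k ≤ a k := by
    intro k
    simp only [ha, hstep k]
    exact hS.norm_zOf_step_sq_add_le hl hμ hα w hx
  have hb0 : ∀ k, 0 ≤ b k := fun k =>
    hS.inner_MQ_nonneg hα.1 (by rw [hw]; linarith) (hxs k) hx.1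
  -- A nonincreasing sequence bounded below converges, so its decrements tend to zero; by `hdb` they
  -- dominate `‖d k‖²` up to a constant.
  have hanti : Antitone a := antitone_nat_of_succ_le fun k => by
    have := mul_nonneg hl.le (hb0 k)
    linarith [hab k]
  have hlim := tendsto_atTop_ciInf hanti ⟨0, by rintro _ ⟨k, rfl⟩; exact sq_nonneg _⟩
  have hdiff : Tendsto (fun k => a k - a (k + 1)) atTop (𝓝 0) := by
    simpa using hlim.sub (hlim.comp (tendsto_add_atTop_nat 1))
  have hpsd : (α • S.R + (1 : ℝ) • S.P).PosSemidef := hS.posSemidef_add hα.1 zero_le_one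
  have hunit : IsUnit (α • S.R + (1 : ℝ) • S.P) :=
    hS.isUnit_of_rank hα.1 zero_le_one (by rw [one_smul]; exact hr)
  set c := specNorm (α • S.R + (1 : ℝ) • S.P)⁻¹ with hc
  have hc0 : 0 ≤ c := norm_nonneg _
  have hdb : ∀ k, ‖d k‖ ^ 2 ≤ c * (4 * l)⁻¹ * (a k - a (k + 1)) := by
    intro k
    have h1 := norm_sq_le_specNorm_inv_mul hpsd hunit (d k)
    have h2 := hS.inner_MQ_ge α μ w (hxs k) hx.1
    rw [hw, add_sub_cancel_left, ← hw] at h2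
    refine h1.trans ?_
    rw [mul_assoc]
    refine mul_le_mul_of_nonneg_left (h2.trans ?_) hc0
    rw [← div_eq_inv_mul, le_div_iff₀ (by positivity)]
    change b k * (4 * l) ≤ _
    linarith [hab k]
  have hd2 : Tendsto (fun k => ‖d k‖ ^ 2) atTop (𝓝 0) := by
    refine squeeze_zero (fun _ => sq_nonneg _) hdb ?_
    simpa using hdiff.const_mul (c * (4 * l)⁻¹)
  have hd1 : Tendsto (fun k => ‖d k‖) atTop (𝓝 0) := by
    simpa using hd2.sqrt
  exact hS.tendsto_of_tendsto_Q (tendsto_of_expOp (by positivity) hd1)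

end Iteration

end CoupledDAE

end

/-! ### The main theorem. -/

theorem theorem2 {s m : ℕ} {n : Fin s → ℕ} (hn : 0 < ∑ i, n i)
    (S : CoupledDAE s m n) (hS : S.Admissible)
    (l μ α : ℝ) (hl : 0 < l) (hμ : 0 ≤ μ) (hα : α ∈ Set.Icc (0 : ℝ) 1)
    (xs : ℕ → L2 S.T (CoupledDAE.Idx n)) (hxs0 : xs 0 ∈ S.dom)
    (hxs : ∀ k, xs (k + 1) = S.step α μ l (xs k))
    (x : L2 S.T (CoupledDAE.Idx n)) (hx : S.IsSolution x) :
    (S.RankCond α μ →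
      (∃ q : ℝ, 0 ≤ q ∧ q < 1 ∧
        q ^ 2 = 1 - 4 * l /
          ((1 + l * specNorm (S.K α μ)) ^ 2 * specNorm ((S.K α μ + S.Jo)⁻¹)) ∧
        (∀ w : ℝ, μ ≤ w → ∀ k,
          wNorm w (S.zOf α μ l (xs (k + 1)) - S.zOf α μ l x)
            ≤ q * wNorm w (S.zOf α μ l (xs k) - S.zOf α μ l x)) ∧
        (∀ k, ‖S.zOf α μ l (xs k) - S.zOf α μ l x‖
            ≤ Real.exp (μ * S.T) * q ^ k * ‖S.zOf α μ l (xs 0) - S.zOf α μ l x‖)) ∧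
      Tendsto (fun k => S.zOf α μ l (xs k)) atTop (𝓝 (S.zOf α μ l x)) ∧
      (∀ k, mulOp S.T S.E (xs k) ∈ H1 S.T (CoupledDAE.Idx n)) ∧
      mulOp S.T S.E x ∈ H1 S.T (CoupledDAE.Idx n) ∧
      Tendsto (fun k => h1Norm (mulOp S.T S.E (xs k) - mulOp S.T S.E x)) atTop (𝓝 0)) ∧
    (S.RankCond α μ ∨ S.RankCond' α → Tendsto xs atTop (𝓝 x)) := by
  have hdom : ∀ k, xs k ∈ S.dom
    | 0 => hxs0
    | k + 1 => by rw [hxs k]; exact hS.step_mem_dom hl hα.1 _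
  have hq : S.RankCond α μ → ∃ q : ℝ, 0 ≤ q ∧ q < 1 ∧ q ^ 2 = S.rate α μ l ∧
        (∀ w : ℝ, μ ≤ w → ∀ k,
          wNorm w (S.zOf α μ l (xs (k + 1)) - S.zOf α μ l x)
            ≤ q * wNorm w (S.zOf α μ l (xs k) - S.zOf α μ l x)) ∧
        (∀ k, ‖S.zOf α μ l (xs k) - S.zOf α μ l x‖
            ≤ Real.exp (μ * S.T) * q ^ k * ‖S.zOf α μ l (xs 0) - S.zOf α μ l x‖) := by
    intro hr
    obtain ⟨h0, h1⟩ := hS.rate_mem hn hl hμ hα.2 hr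
    have hcon : ∀ w : ℝ, μ ≤ w → ∀ k,
        wNorm w (S.zOf α μ l (xs (k + 1)) - S.zOf α μ l x)
          ≤ √(S.rate α μ l) * wNorm w (S.zOf α μ l (xs k) - S.zOf α μ l x) := by
      intro w hw k
      rw [wNorm_eq, wNorm_eq, hxs k]
      refine le_of_sq_le_sq ?_ (mul_nonneg (Real.sqrt_nonneg _) (norm_nonneg _))
      rw [mul_pow, Real.sq_sqrt h0]
      exact hS.norm_zOf_step_sq_le hn hl hμ hα hr hw (hdom k) hx
    refine ⟨√(S.rate α μ l), Real.sqrt_nonneg _, ?_, Real.sq_sqrt h0, hcon, fun k => ?_⟩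
    · rw [Real.sqrt_lt' one_pos]
      simpa using h1
    · have hk : ∀ k, wNorm μ (S.zOf α μ l (xs k) - S.zOf α μ l x) ≤
          √(S.rate α μ l) ^ k * wNorm μ (S.zOf α μ l (xs 0) - S.zOf α μ l x) := by
        intro k
        induction k with
        | zero => simp
        | succ k ih =>
          rw [pow_succ', mul_assoc]
          exact (hcon μ le_rfl k).trans (mul_le_mul_of_nonneg_left ih (Real.sqrt_nonneg _))
      -- The contraction is iterated in the weight `w = μ`, the smallest admissible one, and the
      -- factor `e^{μT}` is paid once on leaving the weighted norm.
      refine (norm_le_expOp hμ _).trans ?_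
      rw [mul_assoc, ← wNorm_eq]
      refine mul_le_mul_of_nonneg_left ((hk k).trans ?_) (Real.exp_pos _).le
      rw [wNorm_eq]
      exact mul_le_mul_of_nonneg_left (norm_expOp_le hμ _) (by positivity)
  have hz : S.RankCond α μ →
      Tendsto (fun k => S.zOf α μ l (xs k)) atTop (𝓝 (S.zOf α μ l x)) := by
    intro hr
    obtain ⟨q, h0, h1, -, -, h2⟩ := hq hr
    rw [tendsto_iff_norm_sub_tendsto_zero]
    refine squeeze_zero (fun _ => norm_nonneg _) h2 ?_
    simpa using ((tendsto_pow_atTop_nhds_zero_of_lt_one h0 h1).const_mul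
      (Real.exp (μ * S.T))).mul_const ‖S.zOf α μ l (xs 0) - S.zOf α μ l x‖
  have hlim : S.RankCond α μ → Tendsto xs atTop (𝓝 x) := fun hr =>
    hS.tendsto_of_tendsto_zOf hl hμ hα.1 hdom hx.1 (hz hr)
  refine ⟨fun hr => ⟨hq hr, hz hr, fun k => (hdom k).1, hx.1.1,
    hS.tendsto_h1Norm hl hdom hx.1 (hlim hr) (hz hr)⟩, ?_⟩
  rintro (hr | hr)
  · exact hlim hr
  · exact hS.tendsto_of_rankCond' hl hμ hα hr hdom hx hxs
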